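/- Let $N_c,N_b,K\ge 1$ and $N_u$ be the numbers of cells, of antennas per base station, of subcarriers and of users per cell. Let $0<\alpha<1$, $\beta=1-\alpha$, $\sigma>0$, targets $\gamma_{i,u,k}>0$, and channel vectors $\mathbf g_{j,i,u}(k)\in\mathbb C^{N_b}$ (from base station $j$ to user $u$ of cell $i$ at subcarrier $k$) be given. Let $\mathbf G_{j,i}(k)$ be the matrix with columns $\mathbf g_{j,i,u}(k)$, $u=1,\dots,N_u$; let $\underline{\mathbf G}_{j,i}=\mathrm{blkdiag}(\mathbf G_{j,i}(0),\dots,\mathbf G_{j,i}(K-1))$, $\underline{\mathbf G}_i=[\underline{\mathbf G}_{i,1},\dots,\underline{\mathbf G}_{i,N_c}]$, and let $\underline{\mathbf g}_{j,i,u}(k)$ be the column of $\underline{\mathbf G}_{j,i}$ that belongs to subcarrier $k$ and user $u$. Let $\mathbf W_{\rm DFT}$ be the normalized $K\times K$ DFT matrix, $\boldsymbol\Psi=\mathbf W_{\rm DFT}\otimes\mathbf I_{N_b}$, and $\boldsymbol\Psi(k)$ the $k$-th block row of $\boldsymbol\Psi$. For a square matrix $\mathbf A$, $\mathrm{diag}(\mathbf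 A)$ is the diagonal matrix with the diagonal of $\mathbf A$. **Downlink problem.** For beamformers $\mathbf w_{i,u}(k)\in\mathbb C^{N_b}$ put $\mathbf W_i(k)=[\mathbf w_{i,1}(k),\dots,\mathbf w_{i,N_u}(k)]$, $\underline{\mathbf W}_i=\mathrm{blkdiag}(\mathbf W_i(0),\dots,\mathbf W_i(K-1))$ and $\mathbf C_i=\alpha\beta\,\mathrm{diag}(\boldsymbol\Psi^H\underline{\mathbf W}_i\underline{\mathbf W}_i^H\boldsymbol\Psi)$. The transmitted signal is $\underline{\mathbf x}_{{\rm q},i}=\alpha\underline{\mathbf x}_i+\underline{\mathbf q}_i$ with $\underline{\mathbf x}_i=\boldsymbol\Psi^H\underline{\mathbf W}_i\underline{\mathbf s}_i$, where the symbols $\underline{\mathbf s}_i$ and the quantization noise $\underline{\mathbf q}_i$ are square-integrable, $\mathbb E[\underline{\mathbf s}_i\underline{\mathbf s}_i^H]=\mathbf I$, $\mathbb E[\underline{\mathbf q}_i\underline{\mathbf q}_i^H]=\mathbf C_i$ and $\mathbb E[\underline{\mathbf x}_i\underline{\mathbf q}_i^H]=0$. Let $$\Gamma_{i,u}(k)=\frac{\alpha^2|\mathbf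 g_{i,i,u}^H(k)\mathbf w_{i,u}(k)|^2}{I_{i,u}(k)+Q_{i,u}(k)+\sigma^2},\quad I_{i,u}(k)=\alpha^2\!\!\sum_{(j,v)\ne(i,u)}\!\!|\mathbf g_{j,i,u}^H(k)\mathbf w_{j,v}(k)|^2,\quad Q_{i,u}(k)=\sum_{j}\underline{\mathbf g}_{j,i,u}^H(k)\boldsymbol\Psi\mathbf C_j\boldsymbol\Psi^H\underline{\mathbf g}_{j,i,u}(k).$$ Let $p^\star\in(-\infty,\infty]$ be the infimum of $p_0\in\mathbb R$ over all $(\mathbf w,p_0)$ with $\Gamma_{i,u}(k)\ge\gamma_{i,u,k}$ for all $i,u,k$ and $\big[\mathbb E[\mathbf x_{{\rm q},i}(k)\mathbf x_{{\rm q},i}^H(k)]\big]_{m,m}\le p_0$ for all $i,k,m$ (with $p^\star=\infty$ if there are none). **Lagrangian dual.** Let $d^\star$ be the supremum over $\mu_{i,u}(k)\ge0$, $\nu_{i,m}(k)\ge0$ of the infimum over all $\mathbf w$ and all $p_0\in\mathbb R$ of $$KN_cN_b\,p_0-\sum_{i,u,k}\mu_{i,u}(k)\Big(\tfrac{\alpha^2|\mathbf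 g_{i,i,u}^H(k)\mathbf w_{i,u}(k)|^2}{\gamma_{i,u,k}}-I_{i,u}(k)-Q_{i,u}(k)-\sigma^2\Big)+\sum_{i,m,k}\nu_{i,m}(k)\Big(\big[\mathbb E[\mathbf x_{{\rm q},i}(k)\mathbf x_{{\rm q},i}^H(k)]\big]_{m,m}-p_0\Big).$$ **Virtual uplink problem.** Let $$u^\star=\sup_{\mathbf D}\ \inf_{\lambda}\ \sum_{i,u,k}\lambda_{i,u}(k)\,\sigma^2,$$ where $\mathbf D=(\mathbf D_i)_i$ ranges over the families of real diagonal $N_b\times N_b$ matrices $\mathbf D_i\succeq0$ with $\sum_i\mathrm{tr}(\mathbf D_i)\le N_cN_b$, and $\lambda$ over the families $\lambda_{i,u}(k)\ge0$ with $\max_{\mathbf f\in\mathbb C^{N_b}}\hat\Gamma_{i,u}(k)\ge\gamma_{i,u,k}$ for all $i,u,k$ (the infimum over no $\lambda$ being $\infty$). Here, with $\underline{\boldsymbol\Lambda}$ the diagonal matrix of all $\lambda_{j,v}(k)$ in the order of the columns of $\underline{\mathbf G}_i$, $$\hat\Gamma_{i,u}(k)=\frac{\alpha^2\lambda_{i,u}(k)|\mathbf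 f^H\mathbf g_{i,i,u}(k)|^2}{\mathbf f^H\mathbf Z_{i,u}(k)\mathbf f},\qquad \mathbf Z_{i,u}(k)=\alpha^2\!\!\sum_{(j,v)\neq(i,u)}\!\!\lambda_{j,v}(k)\mathbf g_{i,j,v}(k)\mathbf g_{i,j,v}^H(k)+\alpha^2\mathbf D_i+\hat{\mathbf C}_i(k),$$ $$\hat{\mathbf C}_i(k)=\alpha\beta\,\boldsymbol\Psi(k)\,\mathrm{diag}\big(\boldsymbol\Psi^H\underline{\mathbf G}_i\underline{\boldsymbol\Lambda}\,\underline{\mathbf G}_i^H\boldsymbol\Psi+\mathbf I_K\otimes\mathbf D_i\big)\boldsymbol\Psi(k)^H,$$ and $\hat\Gamma_{i,u}(k)$ is read as $0$ where its denominator vanishes (its numerator then vanishes too). **Strong duality.** There is zero duality gap: in $(-\infty,\infty]$, $$d^\star=u^\star=KN_cN_b\,p^\star .$$ -/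

import Mathlib

open MeasureTheory
open scoped Matrix Kronecker ComplexConjugate

noncomputable section

namespace QuantizedCoMP

/-- A choice of precoding matrices `W_i(k)`, one for each cell `i` and subcarrier `k`; the
`u`-th column of `W_i(k)` is the beamformer `w_{i,u}(k)`. -/
abbrev Beamformers (Nc Nu Nb K : ℕ) : Type :=
  Fin Nc → Fin K → Matrix (Fin Nb) (Fin Nu) ℂ

/-- The data of the multicell downlink: `Nc` cells, `Nu` users per cell, `Nb` antennas per base
station, `K` subcarriers. -/
structure Network (Nc Nu Nb K : ℕ) where
  /-- the quantization gain of the converters -/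
  α : ℝ
  /-- the noise standard deviation -/
  σ : ℝ
  /-- the target SQINR `γ_{i,u,k}` -/
  γ : Fin Nc → Fin Nu → Fin K → ℝ
  /-- `G j i k` is the frequency-domain channel `G_{j,i}(k)` between base station `j` and the
  users of cell `i`; its `u`-th column is `g_{j,i,u}(k)` -/
  G : Fin Nc → Fin Nc → Fin K → Matrix (Fin Nb) (Fin Nu) ℂ
  α_pos : 0 < α
  α_lt_one : α < 1
  σ_pos : 0 < σ
  γ_pos : ∀ i u k, 0 < γ i u k

/-- The normalized discrete Fourier transform matrix. -/
def dft (K : ℕ) : Matrix (Fin K) (Fin K) ℂ :=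
  Matrix.of fun k n =>
    Complex.exp (-(2 * Real.pi * Complex.I * (k : ℕ) * (n : ℕ) / K)) / (Real.sqrt K : ℝ)

/-- `Ψ = W_DFT ⊗ I`. -/
def Psi (K Nb : ℕ) : Matrix (Fin K × Fin Nb) (Fin K × Fin Nb) ℂ :=
  dft K ⊗ₖ (1 : Matrix (Fin Nb) (Fin Nb) ℂ)

/-- `Ψ(k)`, the `k`-th row of the DFT matrix tensored with the identity. -/
def PsiRow (K Nb : ℕ) (k : Fin K) : Matrix (Fin Nb) (Fin K × Fin Nb) ℂ :=
  (Psi K Nb).submatrix (fun m => (k, m)) id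

/-- `blkdiag(A(0), …, A(K-1))`, with rows and columns indexed by (subcarrier, position). -/
def blkdiag {K m n : ℕ} (A : Fin K → Matrix (Fin m) (Fin n) ℂ) :
    Matrix (Fin K × Fin m) (Fin K × Fin n) ℂ :=
  Matrix.of fun p q => if p.1 = q.1 then A p.1 p.2 q.2 else 0

variable {Nc Nu Nb K : ℕ}

/-- `β = 1 - α`. -/
def Network.β (S : Network Nc Nu Nb K) : ℝ := 1 - S.α

/-- The channel vector `g_{j,i,u}(k)`. -/
def Network.chan (S : Network Nc Nu Nb K) (j i : Fin Nc) (u : Fin Nu) (k : Fin K) :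
    Fin Nb → ℂ :=
  fun m => S.G j i k m u

/-- The stacked channel vector of user `u` of cell `i` at subcarrier `k`: the column of
`blkdiag(G_{j,i}(0), …, G_{j,i}(K-1))` with index `(k, u)`. -/
def Network.stackedChan (S : Network Nc Nu Nb K) (j i : Fin Nc) (u : Fin Nu) (k : Fin K) :
    Fin K × Fin Nb → ℂ :=
  fun p => blkdiag (S.G j i) p (k, u)

/-- The vector `w_{i,u}(k)`. -/
def beam (w : Beamformers Nc Nu Nb K) (i : Fin Nc) (u : Fin Nu) (k : Fin K) : Fin Nb → ℂ :=
  fun m => w i k m u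

/-! ### The downlink -/

/-- The covariance matrix `αβ diag(Ψᴴ W_i W_iᴴ Ψ)` of the quantization noise at base
station `i`. -/
def quantCov (S : Network Nc Nu Nb K) (w : Beamformers Nc Nu Nb K) (i : Fin Nc) :
    Matrix (Fin K × Fin Nb) (Fin K × Fin Nb) ℂ :=
  ((S.α * S.β : ℝ) : ℂ) • Matrix.diagonal
    (((Psi K Nb)ᴴ * blkdiag (w i) * (blkdiag (w i))ᴴ * Psi K Nb).diag)

/-- The interference power `I_{i,u}(k)`. -/
def interference (S : Network Nc Nu Nb K) (w : Beamformers Nc Nu Nb K)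
    (i : Fin Nc) (u : Fin Nu) (k : Fin K) : ℝ :=
  S.α ^ 2 * ∑ p ∈ (Finset.univ : Finset (Fin Nc × Fin Nu)).erase (i, u),
    ‖star (S.chan p.1 i u k) ⬝ᵥ beam w p.1 p.2 k‖ ^ 2

/-- The received quantization noise power `Q_{i,u}(k)`. -/
def quantNoise (S : Network Nc Nu Nb K) (w : Beamformers Nc Nu Nb K)
    (i : Fin Nc) (u : Fin Nu) (k : Fin K) : ℝ :=
  (∑ j, star (S.stackedChan j i u k) ⬝ᵥ
    ((Psi K Nb * quantCov S w j * (Psi K Nb)ᴴ) *ᵥ S.stackedChan j i u k)).re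

/-- The downlink SQINR `Γ_{i,u}(k)`. -/
def sqinr (S : Network Nc Nu Nb K) (w : Beamformers Nc Nu Nb K)
    (i : Fin Nc) (u : Fin Nu) (k : Fin K) : ℝ :=
  S.α ^ 2 * ‖star (S.chan i i u k) ⬝ᵥ beam w i u k‖ ^ 2 /
    (interference S w i u k + quantNoise S w i u k + S.σ ^ 2)

/-- The stacked OFDM signal `x_i = Ψᴴ W_i s_i` for the stacked symbol vector `s_i`. -/
def ofdmSignal (w : Beamformers Nc Nu Nb K) (i : Fin Nc) (s : Fin K × Fin Nu → ℂ) :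
    Fin K × Fin Nb → ℂ :=
  ((Psi K Nb)ᴴ * blkdiag (w i)) *ᵥ s

/-- The random symbols and quantization noises of the additive quantization noise model. Only
their second moments are prescribed: symbols with identity covariance, noise with covariance
`quantCov`, noise uncorrelated with the quantizer input. Symbols distributed as `CN(0, I)` and
noise distributed as `CN(0, quantCov)` are a special case. -/
structure SignalModel (S : Network Nc Nu Nb K) {Ω : Type*} [MeasurableSpace Ω]
    (P : Measure Ω) where
  /-- the stacked symbols of cell `i` -/
  s : Fin Nc → Fin K × Fin Nu → Ω → ℂ
  /-- the stacked quantization noise at base station `i` under the beamformers `w` -/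
  q : Beamformers Nc Nu Nb K → Fin Nc → Fin K × Fin Nb → Ω → ℂ
  memLp_s : ∀ i a, MemLp (s i a) 2 P
  memLp_q : ∀ w i a, MemLp (q w i a) 2 P
  cov_s : ∀ i a b, ∫ ω, s i a ω * conj (s i b ω) ∂P = if a = b then 1 else 0
  cov_q : ∀ w i a b, ∫ ω, q w i a ω * conj (q w i b ω) ∂P = quantCov S w i a b
  uncorrelated : ∀ w i a b,
    ∫ ω, ofdmSignal w i (fun c => s i c ω) a * conj (q w i b ω) ∂P = 0

variable {S : Network Nc Nu Nb K} {Ω : Type*} [MeasurableSpace Ω] {P : Measure Ω}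

/-- The quantized transmit signal `x_{q,i} = α x_i + q_i`. -/
def SignalModel.xq (M : SignalModel S P) (w : Beamformers Nc Nu Nb K) (i : Fin Nc)
    (a : Fin K × Fin Nb) (ω : Ω) : ℂ :=
  (S.α : ℂ) * ofdmSignal w i (fun c => M.s i c ω) a + M.q w i a ω

/-- The transmit power `[E[x_{q,i}(k) x_{q,i}(k)ᴴ]]_{m,m}` of antenna `m`. -/
def SignalModel.antennaPower (M : SignalModel S P) (w : Beamformers Nc Nu Nb K)
    (i : Fin Nc) (k : Fin K) (m : Fin Nb) : ℝ :=
  (∫ ω, M.xq w i (k, m) ω * conj (M.xq w i (k, m) ω) ∂P).re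

/-- The feasible points `(w, p₀)` of the downlink problem. -/
def SignalModel.primalFeasible (M : SignalModel S P) : Set (Beamformers Nc Nu Nb K × ℝ) :=
  {x | (∀ i u k, S.γ i u k ≤ sqinr S x.1 i u k) ∧ ∀ i k m, M.antennaPower x.1 i k m ≤ x.2}

/-- The optimal value of the downlink problem: minimize `p₀`. It is `⊤` if the problem is
infeasible. -/
def SignalModel.primalValue (M : SignalModel S P) : EReal :=
  ⨅ x ∈ M.primalFeasible, (x.2 : EReal)

/-! ### The Lagrangian dual -/

/-- The Lagrangian of the downlink problem with the objective scaled to `K Nc Nb p₀`, with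
multipliers `μ_{i,u}(k)` of the SQINR constraints (cleared of denominators) and `ν_{i,m}(k)` of
the antenna power constraints. -/
def SignalModel.lagrangian (M : SignalModel S P) (w : Beamformers Nc Nu Nb K) (p₀ : ℝ)
    (μ : Fin Nc → Fin Nu → Fin K → ℝ) (ν : Fin Nc → Fin Nb → Fin K → ℝ) : ℝ :=
  (K : ℝ) * Nc * Nb * p₀
    - ∑ i, ∑ u, ∑ k, μ i u k *
        (S.α ^ 2 * ‖star (S.chan i i u k) ⬝ᵥ beam w i u k‖ ^ 2 / S.γ i u k
          - interference S w i u k - quantNoise S w i u k - S.σ ^ 2)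
    + ∑ i, ∑ m, ∑ k, ν i m k * (M.antennaPower w i k m - p₀)

/-- The optimal value of the Lagrangian dual problem. -/
def SignalModel.lagrangeDualValue (M : SignalModel S P) : EReal :=
  ⨆ (μ : Fin Nc → Fin Nu → Fin K → ℝ) (ν : Fin Nc → Fin Nb → Fin K → ℝ)
    (_ : (∀ i u k, 0 ≤ μ i u k) ∧ ∀ i m k, 0 ≤ ν i m k),
    ⨅ (w : Beamformers Nc Nu Nb K) (p₀ : ℝ), (M.lagrangian w p₀ μ ν : EReal)

/-! ### The virtual uplink -/

/-- The horizontal concatenation of the matrices `blkdiag(G_{i,j}(0), …, G_{i,j}(K-1))` over all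
cells `j`. -/
def stackedG (S : Network Nc Nu Nb K) (i : Fin Nc) :
    Matrix (Fin K × Fin Nb) (Fin Nc × (Fin K × Fin Nu)) ℂ :=
  Matrix.of fun p c => blkdiag (S.G i c.1) p c.2

/-- The diagonal matrix of all uplink powers `λ_{j,v}(k)`. -/
def powerMatrix (lam : Fin Nc → Fin Nu → Fin K → ℝ) :
    Matrix (Fin Nc × (Fin K × Fin Nu)) (Fin Nc × (Fin K × Fin Nu)) ℂ :=
  Matrix.diagonal fun c => (lam c.1 c.2.2 c.2.1 : ℂ)

/-- The uplink quantization noise covariance matrix `Ĉ_i(k)`. -/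
def uplinkQuantCov (S : Network Nc Nu Nb K) (lam : Fin Nc → Fin Nu → Fin K → ℝ)
    (D : Fin Nc → Matrix (Fin Nb) (Fin Nb) ℝ) (i : Fin Nc) (k : Fin K) :
    Matrix (Fin Nb) (Fin Nb) ℂ :=
  ((S.α * S.β : ℝ) : ℂ) • (PsiRow K Nb k * Matrix.diagonal
    (((Psi K Nb)ᴴ * stackedG S i * powerMatrix lam * (stackedG S i)ᴴ * Psi K Nb
      + (1 : Matrix (Fin K) (Fin K) ℂ) ⊗ₖ (D i).map Complex.ofReal).diag) * (PsiRow K Nb k)ᴴ)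

/-- The uplink interference-plus-noise covariance matrix `Z_{i,u}(k)`. -/
def uplinkCov (S : Network Nc Nu Nb K) (lam : Fin Nc → Fin Nu → Fin K → ℝ)
    (D : Fin Nc → Matrix (Fin Nb) (Fin Nb) ℝ) (i : Fin Nc) (u : Fin Nu) (k : Fin K) :
    Matrix (Fin Nb) (Fin Nb) ℂ :=
  ((S.α ^ 2 : ℝ) : ℂ) • (∑ p ∈ (Finset.univ : Finset (Fin Nc × Fin Nu)).erase (i, u),
      (lam p.1 p.2 k : ℂ) •
        Matrix.vecMulVec (S.chan i p.1 p.2 k) (star (S.chan i p.1 p.2 k)))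
    + ((S.α ^ 2 : ℝ) : ℂ) • (D i).map Complex.ofReal + uplinkQuantCov S lam D i k

/-- The uplink SQINR of user `u` of cell `i` at subcarrier `k` with the combiner `f`. For
nonnegative powers and positive semidefinite `D`, the numerator vanishes whenever the denominator
does, since `0 < α < 1`; the value of the quotient is then `0`, which meets no positive target. -/
def uplinkSqinr (S : Network Nc Nu Nb K) (lam : Fin Nc → Fin Nu → Fin K → ℝ)
    (D : Fin Nc → Matrix (Fin Nb) (Fin Nb) ℝ) (i : Fin Nc) (u : Fin Nu) (k : Fin K)
    (f : Fin Nb → ℂ) : ℝ :=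
  S.α ^ 2 * lam i u k * ‖star f ⬝ᵥ S.chan i i u k‖ ^ 2 /
    (star f ⬝ᵥ (uplinkCov S lam D i u k *ᵥ f)).re

/-- The uplink powers that are feasible for given noise covariance matrices: nonnegative, and for
each user some combiner attains the target SQINR. -/
def uplinkFeasible (S : Network Nc Nu Nb K) (D : Fin Nc → Matrix (Fin Nb) (Fin Nb) ℝ) :
    Set (Fin Nc → Fin Nu → Fin K → ℝ) :=
  {lam | (∀ i u k, 0 ≤ lam i u k) ∧
    ∀ i u k, ∃ f : Fin Nb → ℂ, S.γ i u k ≤ uplinkSqinr S lam D i u k f}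

/-- The uncertainty set of the uplink noise covariance matrices: diagonal, positive semidefinite,
of total trace at most `Nc Nb`. -/
def noiseSet (Nc Nb : ℕ) : Set (Fin Nc → Matrix (Fin Nb) (Fin Nb) ℝ) :=
  {D | (∀ i, (D i).IsDiag ∧ (D i).PosSemidef) ∧ ∑ i, (D i).trace ≤ (Nc : ℝ) * Nb}

/-- The optimal value of the virtual uplink problem: maximize over the noise covariance matrices
the minimal total uplink power, weighted by `σ²`. -/
def uplinkValue (S : Network Nc Nu Nb K) : EReal :=
  ⨆ D ∈ noiseSet Nc Nb, ⨅ lam ∈ uplinkFeasible S D,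
    ((∑ i, ∑ u, ∑ k, lam i u k * S.σ ^ 2 : ℝ) : EReal)

end QuantizedCoMP

end

/-! The downlink is a quadratic system: each beamformer earns a gain for its user, leaks to the
users and loads the antennas, and the constraints read margin ≥ σ² (`le_sqinr_iff`) and load ≤ p₀.
The only analytic property of the DFT that matters is that its entries have squared modulus 1/K. It
spreads quantization noise evenly and makes the antenna power independent of the subcarrier.

The quadratic constraints hide a convex problem. Two beamformers of a user can be merged into one
(`exists_merge`), so the attainable margins and loads form a convex cone, closed by coercivity. An
infeasible power level is separated from this cone by a hyperplane. Its normal consists of user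
prices λ and antenna prices d under which no beamformer is profitable
(`CoupledSystem.DualFeasible`). Sorted by transmitter, the Lagrangian is a sum of such
per-beamformer losses plus a constant, so these prices, normalized, give K Nc Nb p⋆ ≤ d⋆.

The virtual uplink asks for the opposite inequality: every user has a combiner that covers its cost.
With positive antenna prices, unprofitable prices lie below covering ones by a maximal-ratio
comparison (`CoupledSystem.DualFeasible.le_of_uplinkFeasible`), whence d⋆ ≤ u⋆. Finally, feasible
beamformers serve as combiners: the uplink powers solve a linear system with nonpositive
off-diagonal entries and row sums at least σ², whose inverse is nonnegative
(`exists_nonneg_vecMul_eq`). This gives u⋆ ≤ K Nc Nb p⋆ and closes the cycle. -/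

noncomputable section

namespace QuantizedCoMP

/-! ### Matrices with nonpositive off-diagonal entries and positive row sums -/

section MMatrix

variable {ι : Type*} [Fintype ι] {A : Matrix ι ι ℝ} {s : ℝ}

/-- A minimum principle: at an index `c` where `x` is minimal, all terms `A c b * (x b - x c)` are
nonpositive, so a negative `x c` would force `(A *ᵥ x) c < 0`. -/
theorem nonneg_of_mulVec_nonneg (hA : ∀ a b, a ≠ b → A a b ≤ 0) (hs : 0 < s)
    (hrow : ∀ a, s ≤ ∑ b, A a b) {x : ι → ℝ} (hx : ∀ a, 0 ≤ (A *ᵥ x) a) (a : ι) : 0 ≤ x a := by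
  have : Nonempty ι := ⟨a⟩
  obtain ⟨c, hc⟩ := Finite.exists_min x
  refine le_trans ?_ (hc a)
  by_contra! hneg
  have h1 : (A *ᵥ x) c = ∑ b, A c b * (x b - x c) + x c * ∑ b, A c b := by
    simp only [Matrix.mulVec, dotProduct, Finset.mul_sum, ← Finset.sum_add_distrib]
    exact Finset.sum_congr rfl fun b _ => by ring
  have h2 : ∑ b, A c b * (x b - x c) ≤ 0 := by
    refine Finset.sum_nonpos fun b _ => ?_
    by_cases h : c = b
    · subst h; simp
    · exact mul_nonpos_of_nonpos_of_nonneg (hA c b h) (sub_nonneg.2 (hc b))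
  have h3 : x c * ∑ b, A c b < 0 := mul_neg_of_neg_of_pos hneg (hs.trans_le (hrow c))
  linarith [hx c]

/-- The minimum principle, used four times: on differences it gives injectivity, on the columns of
`A⁻¹` it gives nonnegative entries, and on `1 - A⁻¹ (s 1)` it bounds the row sums of `A⁻¹` by `1 /
s`. -/
theorem exists_nonneg_vecMul_eq (hA : ∀ a b, a ≠ b → A a b ≤ 0) (hs : 0 < s)
    (hrow : ∀ a, s ≤ ∑ b, A a b) {y : ι → ℝ} (hy : ∀ a, 0 ≤ y a) :
    ∃ x : ι → ℝ, (∀ a, 0 ≤ x a) ∧ x ᵥ* A = y ∧ s * ∑ a, x a ≤ ∑ a, y a := by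
  classical
  have hinj : Function.Injective A.mulVec := by
    intro x z hxz
    have h0 : A *ᵥ (x - z) = 0 := by rw [Matrix.mulVec_sub]; exact sub_eq_zero.2 hxz
    have h0' : A *ᵥ (z - x) = 0 := by rw [Matrix.mulVec_sub]; exact sub_eq_zero.2 hxz.symm
    funext a
    have h1 := nonneg_of_mulVec_nonneg hA hs hrow (x := x - z) (fun a => by simp [h0]) a
    have h2 := nonneg_of_mulVec_nonneg hA hs hrow (x := z - x) (fun a => by simp [h0']) a
    simp only [Pi.sub_apply] at h1 h2
    linarith
  have hunit : IsUnit A := Matrix.mulVec_injective_iff_isUnit.1 hinj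
  have hdet : IsUnit A.det := (Matrix.isUnit_iff_isUnit_det A).1 hunit
  have hinv : ∀ a b, 0 ≤ A⁻¹ a b := by
    intro a b
    have := nonneg_of_mulVec_nonneg hA hs hrow (x := A⁻¹ *ᵥ Pi.single b 1) (fun c => by
      rw [Matrix.mulVec_mulVec, Matrix.mul_nonsing_inv A hdet, Matrix.one_mulVec]
      by_cases h : c = b
      · subst h; simp
      · simp [h]) a
    simpa using this
  have hone : ∀ a, s * ∑ b, A⁻¹ a b ≤ 1 := by
    intro a
    have := nonneg_of_mulVec_nonneg hA hs hrow (x := (fun _ => 1) - A⁻¹ *ᵥ (fun _ => s))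
      (fun c => by
        rw [Matrix.mulVec_sub, Matrix.mulVec_mulVec, Matrix.mul_nonsing_inv A hdet,
          Matrix.one_mulVec]
        simpa [Matrix.mulVec, dotProduct] using hrow c) a
    simp only [Pi.sub_apply, Matrix.mulVec, dotProduct, ← Finset.sum_mul] at this
    linarith
  refine ⟨y ᵥ* A⁻¹, fun a => Finset.sum_nonneg fun b _ => mul_nonneg (hy b) (hinv b a), ?_, ?_⟩
  · rw [Matrix.vecMul_vecMul, Matrix.nonsing_inv_mul A hdet, Matrix.vecMul_one]
  · simp only [Matrix.vecMul, dotProduct]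
    rw [Finset.sum_comm, Finset.mul_sum]
    refine Finset.sum_le_sum fun b _ => ?_
    rw [← Finset.mul_sum]
    nlinarith [mul_le_mul_of_nonneg_left (hone b) (hy b)]

end MMatrix

/-! ### Quadratically coupled systems -/

/-- Users `ι` choose vectors of `E`. The vector `f` of user `b` yields the gain `gain b f` to
user `b`, leaks `leak a b f` to user `a` and loads the resource `r` with `load b r f`. All three
are quadratic, and two vectors of a user can be merged into one without losing gain and without
increasing leakage and load. -/
structure CoupledSystem (ι ρ E : Type*) [Fintype ρ] [NormedAddCommGroup E]
    [NormedSpace ℝ E] where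
  gain : ι → E → ℝ
  leak : ι → ι → E → ℝ
  load : ι → ρ → E → ℝ
  gain_smul : ∀ b (t : ℝ) f, gain b (t • f) = t ^ 2 * gain b f
  leak_smul : ∀ a b (t : ℝ) f, leak a b (t • f) = t ^ 2 * leak a b f
  load_smul : ∀ b r (t : ℝ) f, load b r (t • f) = t ^ 2 * load b r f
  leak_nonneg : ∀ a b f, 0 ≤ leak a b f
  load_nonneg : ∀ b r f, 0 ≤ load b r f
  continuous_gain : ∀ b, Continuous (gain b)
  continuous_leak : ∀ a b, Continuous (leak a b)
  continuous_load : ∀ b r, Continuous (load b r)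
  merge : ∀ b f g, ∃ h, gain b f + gain b g ≤ gain b h ∧
    (∀ a, leak a b h ≤ leak a b f + leak a b g) ∧ ∀ r, load b r h ≤ load b r f + load b r g
  coercive : ∃ c : ℝ, 0 < c ∧ ∀ b f, c * ‖f‖ ^ 2 ≤ ∑ r, load b r f
  -- The quantization noise that a user causes to itself; it makes the cost of a useful vector
  -- positive even when all resource prices vanish.
  leak_self_pos : ∀ b f, 0 < gain b f → 0 < leak b b f

namespace CoupledSystem

variable {ι ρ E : Type*} [Fintype ρ] [NormedAddCommGroup E] [NormedSpace ℝ E]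
  {T : CoupledSystem ι ρ E}

theorem gain_zero (b : ι) : T.gain b 0 = 0 := by simpa using T.gain_smul b 0 0

theorem leak_zero (a b : ι) : T.leak a b 0 = 0 := by simpa using T.leak_smul a b 0 0

theorem load_zero (b : ι) (r : ρ) : T.load b r 0 = 0 := by simpa using T.load_smul b r 0 0

theorem exists_load_pos (b : ι) {f : E} (hf : f ≠ 0) : ∃ r, 0 < T.load b r f := by
  obtain ⟨c, hc, h⟩ := T.coercive
  by_contra! hle
  have h1 : 0 < c * ‖f‖ ^ 2 := by positivity
  linarith [h b f, Finset.sum_nonpos fun r (_ : r ∈ Finset.univ) => hle r]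

variable [Fintype ι] (T)

/-- The gain of user `a` minus the leakage it receives. -/
def margin (w : ι → E) (a : ι) : ℝ := T.gain a (w a) - ∑ b, T.leak a b (w b)

/-- The total load of the resource `r`. -/
def totalLoad (w : ι → E) (r : ρ) : ℝ := ∑ b, T.load b r (w b)

/-- The cost of the vector `f` of user `b` when the leakage to user `a` costs `lam a` and the
load of the resource `r` costs `d r`. -/
def cost (lam : ι → ℝ) (d : ρ → ℝ) (b : ι) (f : E) : ℝ :=
  ∑ a, lam a * T.leak a b f + ∑ r, d r * T.load b r f

/-- The prices under which no vector is profitable. -/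
def DualFeasible (lam : ι → ℝ) (d : ρ → ℝ) : Prop :=
  ∀ b f, lam b * T.gain b f ≤ T.cost lam d b f

/-- The prices under which every user has a nontrivial vector that covers its cost. -/
def UplinkFeasible (lam : ι → ℝ) (d : ρ → ℝ) : Prop :=
  -- Strict positivity mirrors the convention that a quotient with vanishing denominator is 0 and
  -- meets no positive target.
  ∀ b, ∃ f, 0 < T.cost lam d b f ∧ T.cost lam d b f ≤ lam b * T.gain b f

variable {T}

theorem cost_zero (lam : ι → ℝ) (d : ρ → ℝ) (b : ι) : T.cost lam d b 0 = 0 := by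
  simp [cost, leak_zero, load_zero]

theorem cost_smul (lam : ι → ℝ) (d : ρ → ℝ) (b : ι) (t : ℝ) (f : E) :
    T.cost lam d b (t • f) = t ^ 2 * T.cost lam d b f := by
  simp only [cost, leak_smul, load_smul, mul_add, Finset.mul_sum]
  congr 1 <;> exact Finset.sum_congr rfl fun _ _ => by ring

theorem cost_add (lam lam' : ι → ℝ) (d d' : ρ → ℝ) (b : ι) (f : E) :
    T.cost (lam + lam') (d + d') b f = T.cost lam d b f + T.cost lam' d' b f := by
  simp only [cost, Pi.add_apply, add_mul, Finset.sum_add_distrib]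
  ring

theorem cost_smul_prices (t : ℝ) (lam : ι → ℝ) (d : ρ → ℝ) (b : ι) (f : E) :
    T.cost (t • lam) (t • d) b f = t * T.cost lam d b f := by
  simp only [cost, Pi.smul_apply, smul_eq_mul, mul_add, Finset.mul_sum, mul_assoc]

theorem cost_nonneg {lam : ι → ℝ} {d : ρ → ℝ} (hlam : ∀ a, 0 ≤ lam a) (hd : ∀ r, 0 ≤ d r)
    (b : ι) (f : E) : 0 ≤ T.cost lam d b f :=
  add_nonneg (Finset.sum_nonneg fun a _ => mul_nonneg (hlam a) (T.leak_nonneg a b f))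
    (Finset.sum_nonneg fun r _ => mul_nonneg (hd r) (T.load_nonneg b r f))

/-- The weighted total margin and load, sorted by the user that causes them. -/
theorem sum_cost_sub_gain (lam : ι → ℝ) (d : ρ → ℝ) (w : ι → E) :
    ∑ b, (T.cost lam d b (w b) - lam b * T.gain b (w b)) =
      ∑ r, d r * T.totalLoad w r - ∑ a, lam a * T.margin w a := by
  simp only [cost, margin, totalLoad, mul_sub, Finset.sum_sub_distrib, Finset.sum_add_distrib,
    Finset.mul_sum]
  rw [Finset.sum_comm (f := fun b a => lam a * T.leak a b (w b)),
    Finset.sum_comm (f := fun b r => d r * T.load b r (w b))]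
  ring

theorem DualFeasible.smul {lam : ι → ℝ} {d : ρ → ℝ} (h : T.DualFeasible lam d) {t : ℝ}
    (ht : 0 ≤ t) : T.DualFeasible (t • lam) (t • d) := fun b f => by
  rw [cost_smul_prices, Pi.smul_apply, smul_eq_mul, mul_assoc]
  exact mul_le_mul_of_nonneg_left (h b f) ht

theorem DualFeasible.add {lam lam' : ι → ℝ} {d d' : ρ → ℝ} (h : T.DualFeasible lam d)
    (h' : T.DualFeasible lam' d') : T.DualFeasible (lam + lam') (d + d') := fun b f => by
  rw [cost_add, Pi.add_apply, add_mul]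
  exact add_le_add (h b f) (h' b f)

theorem dualFeasible_zero {d : ρ → ℝ} (hd : ∀ r, 0 ≤ d r) : T.DualFeasible 0 d := fun b f => by
  simpa using cost_nonneg (T := T) (lam := 0) (fun _ => le_rfl) hd b f

/-- With positive resource prices, dual feasible prices lie below uplink feasible ones. -/
theorem DualFeasible.le_of_uplinkFeasible {lam lam' : ι → ℝ} {d : ρ → ℝ}
    (h : T.DualFeasible lam d) (h' : T.UplinkFeasible lam' d) (hlam' : ∀ a, 0 ≤ lam' a)
    (hd : ∀ r, 0 < d r) (a : ι) : lam a ≤ lam' a := by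
  have hpos : ∀ b, 0 < lam' b := fun b => by
    obtain ⟨f, h1, h2⟩ := h' b
    refine (hlam' b).lt_of_ne fun h0 => ?_
    rw [← h0, zero_mul] at h2
    linarith
  have : Nonempty ι := ⟨a⟩
  -- Compare at the largest ratio `t = lam c / lam' c`, assumed above 1. Passing from `lam'` to
  -- `lam` multiplies the revenue of `c` by exactly `t` and its leakage cost by at most `t`, while
  -- the positive load cost stays fixed. A vector that covered its cost under `lam'` would then be
  -- strictly profitable under `lam`.
  obtain ⟨c, hc⟩ := Finite.exists_max fun b => lam b / lam' b
  by_contra! hlt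
  set t := lam c / lam' c with ht
  have ht1 : 1 < t := lt_of_lt_of_le ((one_lt_div (hpos a)).2 hlt) (hc a)
  have hle : ∀ b, lam b ≤ t * lam' b := fun b => (div_le_iff₀ (hpos b)).1 (hc b)
  have hceq : lam c = t * lam' c := by rw [ht, div_mul_cancel₀ _ (hpos c).ne']
  obtain ⟨f, hf, hf'⟩ := h' c
  have hf0 : f ≠ 0 := by rintro rfl; rw [cost_zero] at hf; exact hf.false
  obtain ⟨r, hr⟩ := T.exists_load_pos c hf0
  have hL : 0 < ∑ r, d r * T.load c r f :=
    Finset.sum_pos' (fun r _ => mul_nonneg (hd r).le (T.load_nonneg c r f))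
      ⟨r, Finset.mem_univ r, mul_pos (hd r) hr⟩
  have hI : ∑ b, lam b * T.leak b c f ≤ t * ∑ b, lam' b * T.leak b c f := by
    rw [Finset.mul_sum]
    refine Finset.sum_le_sum fun b _ => ?_
    rw [← mul_assoc]
    exact mul_le_mul_of_nonneg_right (hle b) (T.leak_nonneg b c f)
  have h1 := h c f
  rw [hceq, mul_assoc] at h1
  simp only [cost] at h1 hf'
  nlinarith [mul_le_mul_of_nonneg_left hf' (zero_le_one.trans ht1.le)]

/-- A feasible downlink yields uplink feasible prices of no larger total value. -/
theorem exists_uplinkFeasible {w : ι → E} {s p ε : ℝ} {d : ρ → ℝ} (hs : 0 < s) (hε : 0 < ε)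
    (hd : ∀ r, 0 ≤ d r) (hw : ∀ a, s ≤ T.margin w a) (hp : ∀ r, T.totalLoad w r ≤ p) :
    ∃ lam : ι → ℝ, (∀ a, 0 ≤ lam a) ∧ T.UplinkFeasible lam d ∧
      s * ∑ a, lam a ≤ p * ∑ r, d r + ε := by
  classical
  -- A slack per user whose total stays below `ε`; the `+ 1` covers the case of no users.
  set δ : ℝ := ε / (Fintype.card ι + 1) with hδ
  have hδ0 : 0 < δ := by positivity
  -- The rows of this matrix sum to the margins. Column `b` of the system says that `w b` earns its
  -- cost plus `δ`, and `δ > 0` forces price and gain of `b` to be positive.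
  obtain ⟨lam, hlam, heq, hsum⟩ := exists_nonneg_vecMul_eq
    (A := Matrix.of fun a b => (if a = b then T.gain a (w a) else 0) - T.leak a b (w b))
    (y := fun b => ∑ r, d r * T.load b r (w b) + δ)
    (fun a b hab => by simpa [hab] using T.leak_nonneg a b (w b)) hs
    (fun a => by simpa [margin, Finset.sum_sub_distrib] using hw a)
    (fun b => add_nonneg (Finset.sum_nonneg fun r _ => mul_nonneg (hd r) (T.load_nonneg b r _))
      hδ0.le)
  refine ⟨lam, hlam, fun b => ⟨w b, ?_⟩, ?_⟩
  · have hb := congrFun heq b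
    simp only [Matrix.vecMul, dotProduct, Matrix.of_apply, mul_sub, mul_ite, mul_zero,
      Finset.sum_sub_distrib, Finset.sum_ite_eq', Finset.mem_univ, if_true] at hb
    have hcost : T.cost lam d b (w b) + δ = lam b * T.gain b (w b) := by
      simp only [cost]; linarith
    have hc0 := T.cost_nonneg hlam hd b (w b)
    have hgl : 0 < lam b * T.gain b (w b) := by linarith
    have hl : 0 < lam b := (hlam b).lt_of_ne fun h0 => by simp [← h0] at hgl
    have hg : 0 < T.gain b (w b) := pos_of_mul_pos_right hgl hl.le
    refine ⟨?_, by linarith⟩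
    have h1 : lam b * T.leak b b (w b) ≤ ∑ a, lam a * T.leak a b (w b) :=
      Finset.single_le_sum (f := fun a => lam a * T.leak a b (w b))
        (fun a _ => mul_nonneg (hlam a) (T.leak_nonneg a b _)) (Finset.mem_univ b)
    have h2 : 0 ≤ ∑ r, d r * T.load b r (w b) :=
      Finset.sum_nonneg fun r _ => mul_nonneg (hd r) (T.load_nonneg b r _)
    have h3 := mul_pos hl (T.leak_self_pos b _ hg)
    simp only [cost]
    linarith
  · refine hsum.trans ?_
    rw [Finset.sum_add_distrib, Finset.sum_comm]
    refine add_le_add ?_ ?_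
    · rw [Finset.mul_sum]
      refine Finset.sum_le_sum fun r _ => ?_
      rw [← Finset.mul_sum, mul_comm p]
      exact mul_le_mul_of_nonneg_left (hp r) (hd r)
    · simp only [Finset.sum_const, Finset.card_univ, nsmul_eq_mul, hδ]
      rw [mul_div_assoc', div_le_iff₀ (by positivity)]
      nlinarith

/-- The margins and loads that can be attained, up to slack. -/
def attainable (T : CoupledSystem ι ρ E) : Set (ι ⊕ ρ → ℝ) :=
  {x | ∃ w : ι → E, (∀ a, x (Sum.inl a) ≤ T.margin w a) ∧
    ∀ r, T.totalLoad w r ≤ x (Sum.inr r)}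

theorem smul_mem_attainable {x : ι ⊕ ρ → ℝ} (hx : x ∈ T.attainable) {t : ℝ} (ht : 0 ≤ t) :
    t • x ∈ T.attainable := by
  obtain ⟨w, hw, hw'⟩ := hx
  refine ⟨fun a => Real.sqrt t • w a, fun a => ?_, fun r => ?_⟩
  · simp only [margin, gain_smul, leak_smul, Real.sq_sqrt ht, ← Finset.mul_sum, ← mul_sub,
      Pi.smul_apply, smul_eq_mul]
    exact mul_le_mul_of_nonneg_left (hw a) ht
  · simp only [totalLoad, load_smul, Real.sq_sqrt ht, ← Finset.mul_sum, Pi.smul_apply,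
      smul_eq_mul]
    exact mul_le_mul_of_nonneg_left (hw' r) ht

/-- Each user merges its two vectors: no gain is lost, while leakage and load at most add up. This
is the source of convexity. -/
theorem add_mem_attainable {x y : ι ⊕ ρ → ℝ} (hx : x ∈ T.attainable) (hy : y ∈ T.attainable) :
    x + y ∈ T.attainable := by
  obtain ⟨w, hw, hw'⟩ := hx
  obtain ⟨v, hv, hv'⟩ := hy
  choose z hz1 hz2 hz3 using fun b => T.merge b (w b) (v b)
  refine ⟨z, fun a => ?_, fun r => ?_⟩
  · have h1 := Finset.sum_le_sum fun b (_ : b ∈ Finset.univ) => hz2 b a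
    rw [Finset.sum_add_distrib] at h1
    have h2 := hw a
    have h3 := hv a
    simp only [margin, Pi.add_apply] at *
    linarith [hz1 a]
  · have h1 := Finset.sum_le_sum fun b (_ : b ∈ Finset.univ) => hz3 b r
    rw [Finset.sum_add_distrib] at h1
    have h2 := hw' r
    have h3 := hv' r
    simp only [totalLoad, Pi.add_apply] at *
    linarith

theorem convex_attainable : Convex ℝ T.attainable := fun _ hx _ hy _ _ ha hb _ =>
  add_mem_attainable (smul_mem_attainable hx ha) (smul_mem_attainable hy hb)

theorem continuous_margin (a : ι) : Continuous fun w => T.margin w a :=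
  ((T.continuous_gain a).comp (continuous_apply a)).sub
    (continuous_finsetSum _ fun b _ => (T.continuous_leak a b).comp (continuous_apply b))

theorem continuous_totalLoad (r : ρ) : Continuous fun w => T.totalLoad w r :=
  continuous_finsetSum _ fun b _ => (T.continuous_load b r).comp (continuous_apply b)

/-- Along a convergent sequence the loads are bounded, so coercivity bounds the vectors; a
convergent subsequence of them attains the limit by continuity. -/
theorem isClosed_attainable [ProperSpace E] : IsClosed T.attainable := by
  refine IsSeqClosed.isClosed fun x y hx hxy => ?_
  choose w hw hw' using hx
  obtain ⟨c, hc, hcoer⟩ := T.coercive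
  have hbdd : ∀ b, ∃ R, ∀ n, ‖w n b‖ ≤ R := fun b => by
    have htend : Filter.Tendsto (fun n => ∑ r, x n (Sum.inr r)) Filter.atTop
        (nhds (∑ r, y (Sum.inr r))) :=
      tendsto_finsetSum _ fun r _ => (continuous_apply (Sum.inr r)).continuousAt.tendsto.comp hxy
    obtain ⟨B, hB⟩ := htend.bddAbove_range
    refine ⟨Real.sqrt (B / c), fun n => Real.le_sqrt_of_sq_le ((le_div_iff₀ hc).2 ?_)⟩
    calc ‖w n b‖ ^ 2 * c = c * ‖w n b‖ ^ 2 := mul_comm _ _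
      _ ≤ ∑ r, T.load b r (w n b) := hcoer b _
      _ ≤ ∑ r, x n (Sum.inr r) := Finset.sum_le_sum fun r _ =>
          (Finset.single_le_sum (f := fun b => T.load b r (w n b))
            (fun b _ => T.load_nonneg b r _) (Finset.mem_univ b)).trans (hw' n r)
      _ ≤ B := hB ⟨n, rfl⟩
  choose R hR using hbdd
  obtain ⟨v, -, φ, hφ, hv⟩ := (isCompact_univ_pi fun b =>
    isCompact_closedBall (0 : E) (R b)).tendsto_subseq (x := w)
      (fun n b _ => by simpa using hR b n)
  refine ⟨v, fun a => ?_, fun r => ?_⟩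
  · exact le_of_tendsto_of_tendsto'
      (((continuous_apply (Sum.inl a)).tendsto y).comp (hxy.comp hφ.tendsto_atTop))
      (((continuous_margin a).tendsto v).comp hv) fun n => hw (φ n) a
  · exact le_of_tendsto_of_tendsto' (((continuous_totalLoad r).tendsto v).comp hv)
      (((continuous_apply (Sum.inr r)).tendsto y).comp (hxy.comp hφ.tendsto_atTop))
      fun n => hw' (φ n) r

/-- Test with families in which a single user is active. -/
theorem dualFeasible_of_nonneg_on_attainable {lam : ι → ℝ} {d : ρ → ℝ}
    (h : ∀ w : ι → E, ∑ a, lam a * T.margin w a ≤ ∑ r, d r * T.totalLoad w r) :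
    T.DualFeasible lam d := by
  classical
  intro b f
  have h1 := h (Pi.single b f)
  have h2 := T.sum_cost_sub_gain lam d (Pi.single b f)
  rw [Finset.sum_eq_single b (fun c _ hc => by
    simp [hc, cost_zero, gain_zero]) (by simp)] at h2
  simp only [Pi.single_eq_same] at h2
  linarith

/-- The separating prices of an infeasible load level. -/
theorem exists_dualFeasible_lt [ProperSpace E] {s p : ℝ}
    (hinf : ¬ ∃ w : ι → E, (∀ a, s ≤ T.margin w a) ∧ ∀ r, T.totalLoad w r ≤ p) :
    ∃ (lam : ι → ℝ) (d : ρ → ℝ), (∀ a, 0 ≤ lam a) ∧ (∀ r, 0 ≤ d r) ∧ T.DualFeasible lam d ∧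
      p * ∑ r, d r < s * ∑ a, lam a := by
  classical
  have hnot : (Sum.elim (fun _ => s) (fun _ => p) : ι ⊕ ρ → ℝ) ∉ T.attainable := hinf
  obtain ⟨φ, u, hu1, hu2⟩ :=
    geometric_hahn_banach_point_closed T.convex_attainable T.isClosed_attainable hnot
  have h0 : (0 : ι ⊕ ρ → ℝ) ∈ T.attainable :=
    ⟨0, fun a => by simp [margin, gain_zero, leak_zero],
      fun r => by simp [totalLoad, load_zero]⟩
  have hu : u < 0 := by simpa using hu2 0 h0
  -- On a cone a functional bounded below is nonnegative: a point with `φ x < 0` could be rescaled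
  -- to take the excluded value `u`.
  have hnn : ∀ x ∈ T.attainable, 0 ≤ φ x := fun x hx => by
    by_contra! hneg
    have := hu2 _ (smul_mem_attainable hx (t := u / φ x) (div_nonneg_of_nonpos hu.le hneg.le))
    rw [map_smul, smul_eq_mul, div_mul_cancel₀ _ hneg.ne] at this
    exact this.false
  have hφ : ∀ x : ι ⊕ ρ → ℝ, φ x = ∑ a, x (Sum.inl a) * φ (Pi.single (Sum.inl a) 1)
      + ∑ r, x (Sum.inr r) * φ (Pi.single (Sum.inr r) 1) := fun x => by
    have := LinearMap.pi_apply_eq_sum_univ (φ : (ι ⊕ ρ → ℝ) →ₗ[ℝ] ℝ) x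
    have hsingle : ∀ i : ι ⊕ ρ, (fun j => if i = j then (1 : ℝ) else 0) = Pi.single i 1 :=
      fun i => by ext j; simp [Pi.single_apply, eq_comm]
    simp only [hsingle, Fintype.sum_sum_type, smul_eq_mul] at this
    exact this
  -- The prices are the coordinates of `φ`, with the sign flipped for margins. They are nonnegative
  -- because lowering a margin or raising a load stays in the cone.
  refine ⟨fun a => -φ (Pi.single (Sum.inl a) 1), fun r => φ (Pi.single (Sum.inr r) 1),
    fun a => ?_, fun r => ?_, dualFeasible_of_nonneg_on_attainable fun w => ?_, ?_⟩
  · change 0 ≤ -φ _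
    rw [← map_neg]
    refine hnn _ ⟨0, fun b => ?_, fun r => ?_⟩
    · by_cases h : b = a <;> simp [margin, gain_zero, leak_zero, h]
    · simp [totalLoad, load_zero]
  · refine hnn _ ⟨0, fun b => ?_, fun q => ?_⟩
    · simp [margin, gain_zero, leak_zero]
    · by_cases h : q = r <;> simp [totalLoad, load_zero, h]
  · have := hnn (Sum.elim (T.margin w) (T.totalLoad w)) ⟨w, fun _ => le_rfl, fun _ => le_rfl⟩
    rw [hφ] at this
    simp only [Sum.elim_inl, Sum.elim_inr] at this
    simp only [neg_mul, Finset.sum_neg_distrib, mul_comm (φ _)]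
    linarith
  · have := hu1.trans hu
    rw [hφ] at this
    simp only [Sum.elim_inl, Sum.elim_inr, ← Finset.mul_sum] at this
    rw [Finset.sum_neg_distrib]
    linarith

/-- The separating prices of an infeasible load level, with the resource prices normalized. -/
theorem exists_dualFeasible_le [ProperSpace E] [Nonempty ρ] {s p κ : ℝ} (hs : 0 < s)
    (hκ : 0 < κ)
    (hinf : ¬ ∃ w : ι → E, (∀ a, s ≤ T.margin w a) ∧ ∀ r, T.totalLoad w r ≤ p) :
    ∃ (lam : ι → ℝ) (d : ρ → ℝ), (∀ a, 0 ≤ lam a) ∧ (∀ r, 0 ≤ d r) ∧ T.DualFeasible lam d ∧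
      ∑ r, d r = κ ∧ κ * p ≤ s * ∑ a, lam a := by
  obtain ⟨lam, d, hlam, hd, hdual, hlt⟩ := exists_dualFeasible_lt hinf
  rcases (Finset.sum_nonneg fun r (_ : r ∈ Finset.univ) => hd r).eq_or_lt with h0 | hpos
  -- Here all resource prices vanish and `∑ a, lam a > 0`. The ray through `lam` is dual feasible,
  -- so the bound can be made as large as needed; adding uniform resource prices, dual feasible with
  -- zero user prices, restores the normalization.
  · rw [← h0, mul_zero] at hlt
    have hlam0 : 0 < ∑ a, lam a := pos_of_mul_pos_right hlt hs.le
    set t := |κ * p| / (s * ∑ a, lam a) with ht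
    have ht0 : 0 ≤ t := by positivity
    have hc : (0 : ℝ) < Fintype.card ρ := by exact_mod_cast Fintype.card_pos
    have hu : ∀ r : ρ, 0 ≤ (fun _ => κ / Fintype.card ρ : ρ → ℝ) r := fun r => by positivity
    refine ⟨t • lam + 0, t • d + fun _ => κ / Fintype.card ρ,
      fun a => by simpa using mul_nonneg ht0 (hlam a),
      fun r => add_nonneg (mul_nonneg ht0 (hd r)) (hu r),
      (hdual.smul ht0).add (dualFeasible_zero hu), ?_, ?_⟩
    · simp only [Pi.add_apply, Pi.smul_apply, smul_eq_mul, Finset.sum_add_distrib,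
        ← Finset.mul_sum, ← h0]
      simp only [Finset.sum_const, Finset.card_univ, nsmul_eq_mul]
      field_simp
      ring
    · simp only [add_zero, Pi.smul_apply, smul_eq_mul, ← Finset.mul_sum]
      have : s * (t * ∑ a, lam a) = |κ * p| := by rw [ht]; field_simp
      rw [this]
      exact le_abs_self _
  · set t := κ / ∑ r, d r with ht
    have ht0 : 0 < t := by positivity
    refine ⟨t • lam, t • d, fun a => mul_nonneg ht0.le (hlam a),
      fun r => mul_nonneg ht0.le (hd r), hdual.smul ht0.le, ?_, ?_⟩
    · simp only [Pi.smul_apply, smul_eq_mul, ← Finset.mul_sum]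
      rw [ht, div_mul_cancel₀ _ hpos.ne']
    · simp only [Pi.smul_apply, smul_eq_mul, ← Finset.mul_sum]
      have h1 : κ = t * ∑ r, d r := by rw [ht, div_mul_cancel₀ _ hpos.ne']
      have h2 := mul_le_mul_of_nonneg_left hlt.le ht0.le
      rw [h1]
      linarith

end CoupledSystem

/-! ### The discrete Fourier transform and diagonal matrices -/

section Fourier

variable {K Nb : ℕ}

theorem dft_mul_conj (k n : Fin K) : dft K k n * conj (dft K k n) = 1 / (K : ℂ) := by
  have h1 : ‖Complex.exp (-(2 * Real.pi * Complex.I * (k : ℕ) * (n : ℕ) / K))‖ = 1 := by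
    rw [show (-(2 * Real.pi * Complex.I * (k : ℕ) * (n : ℕ) / K) : ℂ)
      = ((-(2 * Real.pi * (k : ℕ) * (n : ℕ) / K) : ℝ) : ℂ) * Complex.I by push_cast; ring]
    exact Complex.norm_exp_ofReal_mul_I _
  rw [Complex.mul_conj, Complex.normSq_eq_norm_sq, dft, Matrix.of_apply, norm_div, h1,
    Complex.norm_real, div_pow, Real.norm_eq_abs, sq_abs, Real.sq_sqrt (Nat.cast_nonneg K)]
  simp

theorem Psi_apply (p q : Fin K × Fin Nb) :
    Psi K Nb p q = if p.2 = q.2 then dft K p.1 q.1 else 0 := by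
  simp [Psi, Matrix.kroneckerMap_apply, Matrix.one_apply]

theorem conjTranspose_Psi_mul_apply {c : Type*} [Fintype c] (X : Matrix (Fin K × Fin Nb) c ℂ)
    (κ : c → Fin K) (hX : ∀ k m a, k ≠ κ a → X (k, m) a = 0) (n : Fin K) (m : Fin Nb) (a : c) :
    ((Psi K Nb)ᴴ * X) (n, m) a = conj (dft K (κ a) n) * X (κ a, m) a := by
  rw [Matrix.mul_apply, Finset.sum_eq_single (κ a, m)]
  · simp [Matrix.conjTranspose_apply, Psi_apply]
  · rintro ⟨k, l⟩ - hne
    by_cases hk : k = κ a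
    · have : l ≠ m := fun h => hne (by rw [hk, h])
      simp [Matrix.conjTranspose_apply, Psi_apply, this]
    · rw [hX k l a hk, mul_zero]
  · simp

/-- Each column of `X` lives on a single subcarrier `κ a`, so only one DFT entry, of squared modulus
1/K, meets it. The result does not depend on the time index `n`. -/
theorem conjTranspose_Psi_conj_apply {c : Type*} [Fintype c] [DecidableEq c]
    (X : Matrix (Fin K × Fin Nb) c ℂ) (κ : c → Fin K)
    (hX : ∀ k m a, k ≠ κ a → X (k, m) a = 0) (d : c → ℂ) (n : Fin K) (m : Fin Nb) :
    ((Psi K Nb)ᴴ * X * Matrix.diagonal d * Xᴴ * Psi K Nb) (n, m) (n, m) =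
      1 / (K : ℂ) * ∑ a, d a * ((‖X (κ a, m) a‖ ^ 2 : ℝ) : ℂ) := by
  have h : (Psi K Nb)ᴴ * X * Matrix.diagonal d * Xᴴ * Psi K Nb =
      ((Psi K Nb)ᴴ * X) * Matrix.diagonal d * ((Psi K Nb)ᴴ * X)ᴴ := by
    rw [Matrix.conjTranspose_mul, Matrix.conjTranspose_conjTranspose]
    simp only [Matrix.mul_assoc]
  rw [h, Matrix.mul_apply, Finset.mul_sum]
  refine Finset.sum_congr rfl fun a _ => ?_
  rw [Matrix.mul_diagonal, Matrix.conjTranspose_apply, conjTranspose_Psi_mul_apply X κ hX,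
    ← dft_mul_conj (κ a) n, ← Complex.normSq_eq_norm_sq, ← Complex.mul_conj]
  simp only [RCLike.star_def, map_mul, Complex.conj_conj]
  ring

/-- `Psi` does not mix antennas, and the K time samples contribute weight 1/K each. -/
theorem Psi_diagonal_conj_apply (hK : 0 < K) (e : Fin Nb → ℂ) (k : Fin K) (m l : Fin Nb) :
    (Psi K Nb * Matrix.diagonal (fun p : Fin K × Fin Nb => e p.2) * (Psi K Nb)ᴴ) (k, m) (k, l) =
      if m = l then e m else 0 := by
  rw [Matrix.mul_apply, Fintype.sum_prod_type]
  simp only [Matrix.mul_diagonal, Matrix.conjTranspose_apply, Psi_apply]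
  have hK' : (K : ℂ) ≠ 0 := by exact_mod_cast hK.ne'
  by_cases h : m = l
  · subst h
    simp only [if_true]
    have : ∀ n : Fin K, ∑ x, (if m = x then dft K k n else 0) * e x *
        star (if m = x then dft K k n else 0) = 1 / (K : ℂ) * e m := fun n => by
      rw [Finset.sum_eq_single m (fun b _ hb => by simp [hb.symm]) (by simp),
        ← dft_mul_conj k n]
      simp only [if_true, RCLike.star_def]
      ring
    simp only [this, Finset.sum_const, Finset.card_univ, Fintype.card_fin, nsmul_eq_mul]
    field_simp
  · rw [if_neg h]
    refine Finset.sum_eq_zero fun n _ => Finset.sum_eq_zero fun x _ => ?_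
    by_cases hx : m = x
    · subst hx; simp [Ne.symm h]
    · simp [hx]

end Fourier

variable {Nc Nu Nb K : ℕ}

/-! ### The downlink in terms of antenna energies -/

/-- The energy that the beamformers spend on antenna `m` of base station `j`. -/
def antennaEnergy (w : Beamformers Nc Nu Nb K) (j : Fin Nc) (m : Fin Nb) : ℝ :=
  ∑ u, ∑ k, ‖beam w j u k m‖ ^ 2

theorem diag_signalCov (w : Beamformers Nc Nu Nb K) (i : Fin Nc) (p : Fin K × Fin Nb) :
    ((Psi K Nb)ᴴ * blkdiag (w i) * (blkdiag (w i))ᴴ * Psi K Nb) p p =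
      ((antennaEnergy w i p.2 / K : ℝ) : ℂ) := by
  have h := conjTranspose_Psi_conj_apply (blkdiag (w i)) Prod.fst
    (fun k m a h => by simp [blkdiag, h]) (fun _ => 1) p.1 p.2
  rw [Matrix.diagonal_one, Matrix.mul_one] at h
  rw [h, Fintype.sum_prod_type, Finset.sum_comm, antennaEnergy]
  simp only [blkdiag, Matrix.of_apply, if_true, one_mul, beam]
  push_cast
  ring

theorem quantCov_eq (S : Network Nc Nu Nb K) (w : Beamformers Nc Nu Nb K) (i : Fin Nc) :
    quantCov S w i = Matrix.diagonal fun p : Fin K × Fin Nb =>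
      ((S.α * S.β / K * antennaEnergy w i p.2 : ℝ) : ℂ) := by
  rw [quantCov, ← Matrix.diagonal_smul]
  congr 1
  funext p
  simp only [Pi.smul_apply, Matrix.diag_apply, diag_signalCov, smul_eq_mul]
  push_cast
  ring

theorem quantNoise_eq (hK : 0 < K) (S : Network Nc Nu Nb K) (w : Beamformers Nc Nu Nb K)
    (i : Fin Nc) (u : Fin Nu) (k : Fin K) :
    quantNoise S w i u k = ∑ j, S.α * S.β / K *
      ∑ m, ‖S.chan j i u k m‖ ^ 2 * antennaEnergy w j m := by
  rw [quantNoise, Complex.re_sum]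
  refine Finset.sum_congr rfl fun j _ => ?_
  have hg : ∀ p : Fin K × Fin Nb,
      S.stackedChan j i u k p = if p.1 = k then S.chan j i u k p.2 else 0 := fun p => by
    by_cases h : p.1 = k
    · subst h; simp [Network.stackedChan, Network.chan, blkdiag]
    · simp [Network.stackedChan, blkdiag, h]
  have h1 : star (S.stackedChan j i u k) ⬝ᵥ
      ((Psi K Nb * quantCov S w j * (Psi K Nb)ᴴ) *ᵥ S.stackedChan j i u k) =
      ∑ m, conj (S.chan j i u k m) * ∑ l,
        (Psi K Nb * quantCov S w j * (Psi K Nb)ᴴ) (k, m) (k, l) * S.chan j i u k l := by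
    simp only [dotProduct, Matrix.mulVec, Fintype.sum_prod_type, Pi.star_apply, hg]
    rw [Finset.sum_eq_single k (fun b _ hb => by simp [hb]) (by simp)]
    refine Finset.sum_congr rfl fun m _ => ?_
    rw [Finset.sum_eq_single k (fun b _ hb => by simp [hb]) (by simp)]
    simp
  rw [h1, quantCov_eq]
  have h2 := Psi_diagonal_conj_apply hK
    (fun m : Fin Nb => ((S.α * S.β / K * antennaEnergy w j m : ℝ) : ℂ)) k
  simp only [h2, ite_mul, zero_mul, Finset.sum_ite_eq, Finset.mem_univ, if_true]
  rw [Finset.mul_sum, Complex.re_sum]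
  refine Finset.sum_congr rfl fun m _ => ?_
  rw [← Complex.normSq_eq_norm_sq, mul_left_comm, mul_comm (conj _), Complex.mul_conj,
    ← Complex.ofReal_mul, Complex.ofReal_re]
  ring

/-! ### Second moments of the transmitted signal -/

section Signal

variable {S : Network Nc Nu Nb K} {Ω : Type*} [MeasurableSpace Ω] {P : Measure Ω}

theorem SignalModel.memLp_ofdmSignal (M : SignalModel S P) (w : Beamformers Nc Nu Nb K)
    (i : Fin Nc) (a : Fin K × Fin Nb) :
    MemLp (fun ω => ofdmSignal w i (fun c => M.s i c ω) a) 2 P := by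
  simp only [ofdmSignal, Matrix.mulVec, dotProduct]
  exact memLp_finsetSum _ fun c _ => (M.memLp_s i c).const_mul _

theorem integrable_mul_conj {f g : Ω → ℂ} (hf : MemLp f 2 P) (hg : MemLp g 2 P) :
    Integrable (fun ω => f ω * conj (g ω)) P :=
  hf.integrable_mul hg.star

theorem SignalModel.integral_ofdmSignal (M : SignalModel S P) (w : Beamformers Nc Nu Nb K)
    (i : Fin Nc) (a : Fin K × Fin Nb) :
    ∫ ω, ofdmSignal w i (fun c => M.s i c ω) a * conj (ofdmSignal w i (fun c => M.s i c ω) a) ∂P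
      = ((antennaEnergy w i a.2 / K : ℝ) : ℂ) := by
  rw [← diag_signalCov]
  set H := (Psi K Nb)ᴴ * blkdiag (w i) with hH
  have h1 : (Psi K Nb)ᴴ * blkdiag (w i) * (blkdiag (w i))ᴴ * Psi K Nb = H * Hᴴ := by
    rw [hH, Matrix.conjTranspose_mul, Matrix.conjTranspose_conjTranspose]
    simp only [Matrix.mul_assoc]
  have h2 : ∀ ω, ofdmSignal w i (fun c => M.s i c ω) a *
      conj (ofdmSignal w i (fun c => M.s i c ω) a) =
      ∑ c, ∑ c', H a c * conj (H a c') * (M.s i c ω * conj (M.s i c' ω)) := fun ω => by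
    simp only [ofdmSignal, Matrix.mulVec, dotProduct, map_sum, map_mul, Finset.sum_mul_sum, ← hH]
    exact Finset.sum_congr rfl fun _ _ => Finset.sum_congr rfl fun _ _ => by ring
  have hint : ∀ c c', Integrable
      (fun ω => H a c * conj (H a c') * (M.s i c ω * conj (M.s i c' ω))) P := fun c c' =>
    (integrable_mul_conj (M.memLp_s i c) (M.memLp_s i c')).const_mul _
  simp only [h2]
  rw [integral_finsetSum _ fun c _ => integrable_finsetSum _ fun c' _ => hint c c', h1,
    Matrix.mul_apply]
  refine Finset.sum_congr rfl fun c _ => ?_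
  rw [integral_finsetSum _ fun c' _ => hint c c']
  simp only [integral_const_mul, M.cov_s, mul_ite, mul_one, mul_zero, Finset.sum_ite_eq,
    Finset.mem_univ, if_true, Matrix.conjTranspose_apply, RCLike.star_def]

/-- The cross terms vanish, and signal and quantization noise combine to α² + αβ = α. -/
theorem SignalModel.antennaPower_eq (M : SignalModel S P) (w : Beamformers Nc Nu Nb K)
    (i : Fin Nc) (k : Fin K) (m : Fin Nb) :
    M.antennaPower w i k m = S.α / K * antennaEnergy w i m := by
  set x : Ω → ℂ := fun ω => ofdmSignal w i (fun c => M.s i c ω) (k, m) with hx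
  set q : Ω → ℂ := M.q w i (k, m) with hq
  have hxm : MemLp x 2 P := M.memLp_ofdmSignal w i (k, m)
  have hqm : MemLp q 2 P := M.memLp_q w i (k, m)
  have h1 : ∀ ω, M.xq w i (k, m) ω * conj (M.xq w i (k, m) ω) =
      (S.α : ℂ) ^ 2 * (x ω * conj (x ω)) + (S.α : ℂ) * (x ω * conj (q ω))
        + (S.α : ℂ) * conj (x ω * conj (q ω)) + q ω * conj (q ω) := fun ω => by
    simp only [SignalModel.xq, hx, hq, map_add, map_mul, Complex.conj_ofReal, Complex.conj_conj]
    ring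
  have hxq := integrable_mul_conj hxm hqm
  have hxq' : Integrable (fun ω => conj (x ω * conj (q ω))) P := by
    simpa [mul_comm] using integrable_mul_conj hqm hxm
  have hun : ∫ ω, x ω * conj (q ω) ∂P = 0 := M.uncorrelated w i (k, m) (k, m)
  have hxx : ∫ ω, x ω * conj (x ω) ∂P = ((antennaEnergy w i m / K : ℝ) : ℂ) :=
    M.integral_ofdmSignal w i (k, m)
  have hqq : ∫ ω, q ω * conj (q ω) ∂P = quantCov S w i (k, m) (k, m) := M.cov_q w i _ _
  have hI1 := (integrable_mul_conj hxm hxm).const_mul ((S.α : ℂ) ^ 2)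
  have hI2 := hxq.const_mul (S.α : ℂ)
  have hI3 := hxq'.const_mul (S.α : ℂ)
  rw [SignalModel.antennaPower]
  simp only [h1]
  rw [integral_add ((hI1.fun_add hI2).fun_add hI3) (integrable_mul_conj hqm hqm),
    integral_add (hI1.fun_add hI2) hI3, integral_add hI1 hI2]
  simp only [integral_const_mul]
  rw [integral_conj, hun, hxx, hqq, quantCov_eq, Matrix.diagonal_apply_eq, map_zero, mul_zero,
    add_zero, add_zero, ← Complex.ofReal_pow, ← Complex.ofReal_mul, ← Complex.ofReal_add,
    Complex.ofReal_re, Network.β]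
  ring

end Signal

/-! ### The network as a coupled system -/

/-- Two vectors can be merged such that the power received through `c` adds up and the power
received through any other vector at most adds up. -/
theorem exists_merge {n : ℕ} (c f g : Fin n → ℂ) :
    ∃ h : Fin n → ℂ, ‖c ⬝ᵥ f‖ ^ 2 + ‖c ⬝ᵥ g‖ ^ 2 ≤ ‖c ⬝ᵥ h‖ ^ 2 ∧
      ∀ v : Fin n → ℂ, ‖v ⬝ᵥ h‖ ^ 2 ≤ ‖v ⬝ᵥ f‖ ^ 2 + ‖v ⬝ᵥ g‖ ^ 2 := by
  set a := c ⬝ᵥ f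
  set b := c ⬝ᵥ g
  set R := ‖a‖ ^ 2 + ‖b‖ ^ 2 with hR
  rcases (show 0 ≤ R by positivity).eq_or_lt with h0 | hpos
  · exact ⟨0, by rw [← h0]; positivity, fun v => by simp; positivity⟩
  have hv : ∀ v : Fin n → ℂ,
      ‖v ⬝ᵥ (((Real.sqrt R)⁻¹ : ℝ) : ℂ) • (conj a • f + conj b • g)‖ ^ 2 =
      R⁻¹ * ‖conj a * (v ⬝ᵥ f) + conj b * (v ⬝ᵥ g)‖ ^ 2 := fun v => by
    rw [dotProduct_smul, dotProduct_add, dotProduct_smul, dotProduct_smul, smul_eq_mul,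
      smul_eq_mul, smul_eq_mul, norm_mul, mul_pow, Complex.norm_real, Real.norm_eq_abs, sq_abs,
      inv_pow, Real.sq_sqrt hpos.le]
  -- Matched combining: the coefficients are the conjugates of the two received amplitudes,
  -- normalized. For `v = c` the powers add exactly; for other `v` Cauchy–Schwarz gives the upper
  -- bound.
  refine ⟨(((Real.sqrt R)⁻¹ : ℝ) : ℂ) • (conj a • f + conj b • g), ?_, fun v => ?_⟩
  · have h1 : conj a * a + conj b * b = ((R : ℝ) : ℂ) := by
      rw [mul_comm, Complex.mul_conj, mul_comm, Complex.mul_conj, Complex.normSq_eq_norm_sq,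
        Complex.normSq_eq_norm_sq, hR]
      push_cast
      ring
    rw [hv, h1, Complex.norm_real, Real.norm_eq_abs, sq_abs, pow_two, inv_mul_cancel_left₀ hpos.ne']
  · rw [hv, inv_mul_le_iff₀ hpos]
    have h1 : ‖conj a * (v ⬝ᵥ f) + conj b * (v ⬝ᵥ g)‖ ≤
        ‖a‖ * ‖v ⬝ᵥ f‖ + ‖b‖ * ‖v ⬝ᵥ g‖ := by
      refine (norm_add_le _ _).trans_eq ?_
      rw [norm_mul, norm_mul, RCLike.norm_conj, RCLike.norm_conj]
    refine (pow_le_pow_left₀ (norm_nonneg _) h1 2).trans ?_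
    rw [hR]
    nlinarith [sq_nonneg (‖a‖ * ‖v ⬝ᵥ g‖ - ‖b‖ * ‖v ⬝ᵥ f‖)]

theorem Network.β_pos (S : Network Nc Nu Nb K) : 0 < S.β := sub_pos.2 S.α_lt_one

/-- The coupled system of the users `(i, u, k)` with their beamformers and of the antennas
`(i, m)`. -/
def Network.system (S : Network Nc Nu Nb K) (hK : 0 < K) :
    CoupledSystem (Fin Nc × Fin Nu × Fin K) (Fin Nc × Fin Nb) (Fin Nb → ℂ) where
  gain a f := S.α ^ 2 / S.γ a.1 a.2.1 a.2.2 * ‖star (S.chan a.1 a.1 a.2.1 a.2.2) ⬝ᵥ f‖ ^ 2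
  -- Interference couples distinct users on the same subcarrier only; quantization noise reaches all
  -- subcarriers and the user itself.
  leak a b f :=
    S.α ^ 2 * (if (a.1, a.2.1) ≠ (b.1, b.2.1) ∧ a.2.2 = b.2.2 then
      ‖star (S.chan b.1 a.1 a.2.1 a.2.2) ⬝ᵥ f‖ ^ 2 else 0)
    + S.α * S.β / K * ∑ m, ‖S.chan b.1 a.1 a.2.1 a.2.2 m‖ ^ 2 * ‖f m‖ ^ 2
  -- One resource per antenna suffices, since the antenna power is the same on all subcarriers.
  load b r f := S.α / K * if b.1 = r.1 then ‖f r.2‖ ^ 2 else 0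
  gain_smul b t f := by
    simp only [dotProduct_smul, norm_smul, mul_pow, Real.norm_eq_abs, sq_abs]
    ring
  leak_smul a b t f := by
    simp only [dotProduct_smul, norm_smul, mul_pow, Real.norm_eq_abs, sq_abs, Pi.smul_apply,
      mul_add, Finset.mul_sum]
    congr 1
    · split_ifs <;> ring
    · exact Finset.sum_congr rfl fun _ _ => by ring
  load_smul b r t f := by
    simp only [Pi.smul_apply, norm_smul, mul_pow, Real.norm_eq_abs, sq_abs]
    split_ifs <;> ring
  leak_nonneg a b f := by
    have := S.α_pos
    have := S.β_pos
    refine add_nonneg (mul_nonneg (by positivity) ?_) (by positivity)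
    split_ifs <;> positivity
  load_nonneg b r f := by
    have := S.α_pos
    refine mul_nonneg (by positivity) ?_
    split_ifs <;> positivity
  continuous_gain b := by
    simp only [dotProduct]
    fun_prop
  continuous_leak a b := by
    simp only [dotProduct]
    split_ifs <;> fun_prop
  continuous_load b r := by
    split_ifs <;> fun_prop
  merge b f g := by
    have := S.α_pos
    have := S.β_pos
    have := S.γ_pos b.1 b.2.1 b.2.2
    obtain ⟨h, h1, h2⟩ := exists_merge (star (S.chan b.1 b.1 b.2.1 b.2.2)) f g
    have h3 : ∀ m, ‖h m‖ ^ 2 ≤ ‖f m‖ ^ 2 + ‖g m‖ ^ 2 := fun m => by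
      simpa using h2 (Pi.single m 1)
    refine ⟨h, ?_, fun a => ?_, fun r => ?_⟩
    · rw [← mul_add]
      exact mul_le_mul_of_nonneg_left h1 (by positivity)
    · rw [add_add_add_comm, ← mul_add, ← mul_add, ← Finset.sum_add_distrib]
      refine add_le_add (mul_le_mul_of_nonneg_left ?_ (by positivity))
        (mul_le_mul_of_nonneg_left (Finset.sum_le_sum fun m _ => ?_) (by positivity))
      · split_ifs
        · exact h2 _
        · simp
      · rw [← mul_add]
        exact mul_le_mul_of_nonneg_left (h3 m) (by positivity)
    · rw [← mul_add]
      refine mul_le_mul_of_nonneg_left ?_ (by positivity)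
      split_ifs
      · exact h3 _
      · simp
  coercive := by
    have hα := S.α_pos
    have hK' : (0 : ℝ) < K := by exact_mod_cast hK
    refine ⟨S.α / K, by positivity, fun b f => ?_⟩
    rw [← Finset.mul_sum]
    refine mul_le_mul_of_nonneg_left ?_ (by positivity)
    rw [Fintype.sum_prod_type, Finset.sum_eq_single b.1
      (fun j _ hj => by simp [hj.symm]) (by simp)]
    simp only [if_true]
    rw [← Real.le_sqrt (norm_nonneg f) (Finset.sum_nonneg fun m _ => sq_nonneg ‖f m‖)]
    refine (pi_norm_le_iff_of_nonneg (Real.sqrt_nonneg _)).2 fun m => Real.le_sqrt_of_sq_le ?_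
    exact Finset.single_le_sum (f := fun m => ‖f m‖ ^ 2) (fun m _ => by positivity)
      (Finset.mem_univ m)
  leak_self_pos b f hf := by
    have hα := S.α_pos
    have hβ := S.β_pos
    have hK' : (0 : ℝ) < K := by exact_mod_cast hK
    simp only [ne_eq, not_true_eq_false, false_and, if_false, mul_zero, zero_add]
    refine mul_pos (by positivity) ?_
    -- Without quantization noise from its own beam, every product of channel and beamformer entries
    -- vanishes, and with them the gain.
    by_contra! hle
    have h0 := (Finset.sum_eq_zero_iff_of_nonneg (fun m _ => by positivity)).1
      (hle.antisymm (Finset.sum_nonneg fun m _ => by positivity))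
    have h1 : star (S.chan b.1 b.1 b.2.1 b.2.2) ⬝ᵥ f = 0 := by
      refine Finset.sum_eq_zero fun m hm => ?_
      rcases mul_eq_zero.1 (h0 m hm) with h | h
      · simp [norm_eq_zero.1 (pow_eq_zero_iff two_ne_zero |>.1 h)]
      · simp [norm_eq_zero.1 (pow_eq_zero_iff two_ne_zero |>.1 h)]
    simp [h1] at hf

theorem sum_interferers (i : Fin Nc) (u : Fin Nu) (k : Fin K) (F : Fin Nc → Fin Nu → Fin K → ℝ) :
    (∑ b : Fin Nc × Fin Nu × Fin K,
      if (i, u) ≠ (b.1, b.2.1) ∧ k = b.2.2 then F b.1 b.2.1 b.2.2 else 0) =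
    ∑ p ∈ (Finset.univ : Finset (Fin Nc × Fin Nu)).erase (i, u), F p.1 p.2 k := by
  have h : (Finset.univ : Finset (Fin Nc × Fin Nu)).erase (i, u) =
      Finset.univ.filter fun p => (i, u) ≠ p := by
    ext p; simp [eq_comm]
  rw [h, Finset.sum_filter, Fintype.sum_prod_type, Fintype.sum_prod_type]
  refine Finset.sum_congr rfl fun j _ => ?_
  rw [Fintype.sum_prod_type]
  refine Finset.sum_congr rfl fun v _ => ?_
  by_cases hp : (i, u) = (j, v) <;> simp [hp]

/-- The beamformers as a family indexed by the users. -/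
def beams (w : Beamformers Nc Nu Nb K) (b : Fin Nc × Fin Nu × Fin K) : Fin Nb → ℂ :=
  beam w b.1 b.2.1 b.2.2

theorem interference_add_quantNoise (hK : 0 < K) (S : Network Nc Nu Nb K)
    (w : Beamformers Nc Nu Nb K) (i : Fin Nc) (u : Fin Nu) (k : Fin K) :
    interference S w i u k + quantNoise S w i u k =
      ∑ b, (S.system hK).leak (i, u, k) b (beams w b) := by
  simp only [Network.system, beams, Finset.sum_add_distrib, ← Finset.mul_sum]
  rw [sum_interferers i u k fun j v k' => ‖star (S.chan j i u k) ⬝ᵥ beam w j v k'‖ ^ 2,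
    quantNoise_eq hK, ← Finset.mul_sum, interference]
  congr 2
  rw [Fintype.sum_prod_type]
  refine Finset.sum_congr rfl fun j _ => ?_
  rw [Finset.sum_comm]
  refine Finset.sum_congr rfl fun m _ => ?_
  simp only [antennaEnergy, Fintype.sum_prod_type, Finset.mul_sum]

theorem le_sqinr_iff (hK : 0 < K) (S : Network Nc Nu Nb K) (w : Beamformers Nc Nu Nb K)
    (i : Fin Nc) (u : Fin Nu) (k : Fin K) :
    S.γ i u k ≤ sqinr S w i u k ↔ S.σ ^ 2 ≤ (S.system hK).margin (beams w) (i, u, k) := by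
  have hσ := S.σ_pos
  have hγ := S.γ_pos i u k
  have h0 : 0 ≤ ∑ b, (S.system hK).leak (i, u, k) b (beams w b) :=
    Finset.sum_nonneg fun b _ => (S.system hK).leak_nonneg _ _ _
  have hg : (S.system hK).gain (i, u, k) (beams w (i, u, k)) =
      S.α ^ 2 * ‖star (S.chan i i u k) ⬝ᵥ beam w i u k‖ ^ 2 / S.γ i u k := by
    simp only [Network.system, beams]
    ring
  rw [sqinr, interference_add_quantNoise hK, CoupledSystem.margin, hg,
    le_div_iff₀ (by positivity), le_sub_iff_add_le, le_div_iff₀ hγ]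
  constructor <;> intro h <;> linarith

section Signal

variable {S : Network Nc Nu Nb K} {Ω : Type*} [MeasurableSpace Ω] {P : Measure Ω}

theorem SignalModel.antennaPower_eq_totalLoad (M : SignalModel S P) (hK : 0 < K)
    (w : Beamformers Nc Nu Nb K) (i : Fin Nc) (k : Fin K) (m : Fin Nb) :
    M.antennaPower w i k m = (S.system hK).totalLoad (beams w) (i, m) := by
  simp only [antennaPower_eq, CoupledSystem.totalLoad, Network.system, ← Finset.mul_sum]
  rw [Fintype.sum_prod_type, Finset.sum_eq_single i (fun j _ hj => by simp [hj]) (by simp),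
    Fintype.sum_prod_type]
  simp [antennaEnergy, beams]

theorem SignalModel.mem_primalFeasible_iff (M : SignalModel S P) (hK : 0 < K)
    (w : Beamformers Nc Nu Nb K) (p₀ : ℝ) :
    (w, p₀) ∈ M.primalFeasible ↔ (∀ a, S.σ ^ 2 ≤ (S.system hK).margin (beams w) a) ∧
      ∀ r, (S.system hK).totalLoad (beams w) r ≤ p₀ := by
  simp only [primalFeasible, Set.mem_ofPred_eq, le_sqinr_iff hK, M.antennaPower_eq_totalLoad hK,
    Prod.forall]
  exact and_congr_right fun _ => ⟨fun h i m => h i ⟨0, hK⟩ m, fun h i _ m => h i m⟩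

/-- Sorting by transmitter decouples the beamformers, and `ν` enters only through its sums over `k`.
The dual function can thus be read off: `p₀` forces the normalization of `ν`, and each beamformer
forces dual feasibility. -/
theorem SignalModel.lagrangian_eq (M : SignalModel S P) (hK : 0 < K)
    (w : Beamformers Nc Nu Nb K) (p₀ : ℝ) (μ : Fin Nc → Fin Nu → Fin K → ℝ)
    (ν : Fin Nc → Fin Nb → Fin K → ℝ) :
    M.lagrangian w p₀ μ ν =
      ((K : ℝ) * Nc * Nb - ∑ r : Fin Nc × Fin Nb, ∑ k, ν r.1 r.2 k) * p₀
      + S.σ ^ 2 * ∑ a : Fin Nc × Fin Nu × Fin K, μ a.1 a.2.1 a.2.2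
      + ∑ b, ((S.system hK).cost (fun a => μ a.1 a.2.1 a.2.2) (fun r => ∑ k, ν r.1 r.2 k) b
          (beams w b) - μ b.1 b.2.1 b.2.2 * (S.system hK).gain b (beams w b)) := by
  have hm : ∀ i u k, S.α ^ 2 * ‖star (S.chan i i u k) ⬝ᵥ beam w i u k‖ ^ 2 / S.γ i u k
      - interference S w i u k - quantNoise S w i u k - S.σ ^ 2 =
      (S.system hK).margin (beams w) (i, u, k) - S.σ ^ 2 := fun i u k => by
    rw [CoupledSystem.margin, ← interference_add_quantNoise hK]
    simp only [Network.system, beams]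
    ring
  have e1 : ∑ i, ∑ u, ∑ k, μ i u k * ((S.system hK).margin (beams w) (i, u, k) - S.σ ^ 2) =
      ∑ a : Fin Nc × Fin Nu × Fin K,
        μ a.1 a.2.1 a.2.2 * ((S.system hK).margin (beams w) a - S.σ ^ 2) := by
    simp only [Fintype.sum_prod_type]
  have e2 : ∑ i, ∑ m, ∑ k, ν i m k * ((S.system hK).totalLoad (beams w) (i, m) - p₀) =
      ∑ r : Fin Nc × Fin Nb,
        (∑ k, ν r.1 r.2 k) * ((S.system hK).totalLoad (beams w) r - p₀) := by
    simp only [Fintype.sum_prod_type, Finset.sum_mul]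
  simp only [lagrangian, hm, M.antennaPower_eq_totalLoad hK, e1, e2]
  rw [(S.system hK).sum_cost_sub_gain (fun a => μ a.1 a.2.1 a.2.2) (fun r => ∑ k, ν r.1 r.2 k)]
  simp only [mul_sub, Finset.sum_sub_distrib, ← Finset.sum_mul]
  ring

end Signal

/-! ### The virtual uplink as the dual system -/

theorem uplinkQuantCov_eq (hK : 0 < K) (S : Network Nc Nu Nb K)
    (lam : Fin Nc → Fin Nu → Fin K → ℝ) (D : Fin Nc → Matrix (Fin Nb) (Fin Nb) ℝ) (i : Fin Nc)
    (k : Fin K) :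
    uplinkQuantCov S lam D i k = Matrix.diagonal fun m =>
      ((S.α * S.β * ((∑ a : Fin Nc × Fin Nu × Fin K,
        lam a.1 a.2.1 a.2.2 * ‖S.chan i a.1 a.2.1 a.2.2 m‖ ^ 2) / K + D i m m) : ℝ) : ℂ) := by
  have h1 : ((Psi K Nb)ᴴ * stackedG S i * powerMatrix lam * (stackedG S i)ᴴ * Psi K Nb
      + (1 : Matrix (Fin K) (Fin K) ℂ) ⊗ₖ (D i).map Complex.ofReal).diag =
      fun p : Fin K × Fin Nb => (((∑ a : Fin Nc × Fin Nu × Fin K,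
        lam a.1 a.2.1 a.2.2 * ‖S.chan i a.1 a.2.1 a.2.2 p.2‖ ^ 2) / K + D i p.2 p.2 : ℝ) : ℂ) := by
    funext p
    rw [Matrix.diag_apply, Matrix.add_apply, powerMatrix,
      conjTranspose_Psi_conj_apply (stackedG S i) (fun c => c.2.1)
        (fun k m a h => by simp [stackedG, blkdiag, h]) _ p.1 p.2]
    simp only [Fintype.sum_prod_type]
    simp only [stackedG, blkdiag, Matrix.of_apply, if_true, Matrix.kroneckerMap_apply,
      Matrix.one_apply_eq, one_mul, Matrix.map_apply, Network.chan]
    push_cast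
    rw [one_div, inv_mul_eq_div]
    congr 2
    exact Finset.sum_congr rfl fun j _ => Finset.sum_comm
  rw [uplinkQuantCov, h1]
  ext m l
  rw [Matrix.smul_apply]
  have h2 := Psi_diagonal_conj_apply hK (fun m : Fin Nb => (((∑ a : Fin Nc × Fin Nu × Fin K,
        lam a.1 a.2.1 a.2.2 * ‖S.chan i a.1 a.2.1 a.2.2 m‖ ^ 2) / K + D i m m : ℝ) : ℂ)) k m l
  -- By definition, the product with the block row `PsiRow K Nb k` is the `(k, k)` block of the
  -- product with `Psi`.
  refine (congrArg (((S.α * S.β : ℝ) : ℂ) • ·) h2).trans ?_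
  rw [Matrix.diagonal_apply]
  split_ifs
  · simp only [smul_eq_mul]
    push_cast
    ring
  · simp

theorem re_dotProduct_diagonal_mulVec {n : ℕ} (e : Fin n → ℝ) (f : Fin n → ℂ) :
    (star f ⬝ᵥ (Matrix.diagonal (fun m => (e m : ℂ)) *ᵥ f)).re = ∑ m, e m * ‖f m‖ ^ 2 := by
  rw [dotProduct, Complex.re_sum]
  refine Finset.sum_congr rfl fun m _ => ?_
  rw [Matrix.mulVec_diagonal, Pi.star_apply, RCLike.star_def, mul_left_comm,
    mul_comm (conj (f m)), Complex.mul_conj, Complex.normSq_eq_norm_sq, ← Complex.ofReal_mul,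
    Complex.ofReal_re]

theorem norm_star_dotProduct_comm {n : ℕ} (f c : Fin n → ℂ) :
    ‖star f ⬝ᵥ c‖ = ‖star c ⬝ᵥ f‖ := by
  rw [← norm_star (star c ⬝ᵥ f), ← Matrix.star_dotProduct_star, star_star, dotProduct_comm]

theorem re_dotProduct_vecMulVec_mulVec {n : ℕ} (c f : Fin n → ℂ) :
    (star f ⬝ᵥ (Matrix.vecMulVec c (star c) *ᵥ f)).re = ‖star c ⬝ᵥ f‖ ^ 2 := by
  have h : star f ⬝ᵥ c = conj (star c ⬝ᵥ f) := by
    rw [starRingEnd_apply, ← Matrix.star_dotProduct_star, star_star, dotProduct_comm]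
  rw [Matrix.vecMulVec_mulVec, dotProduct_smul, h]
  simp only [MulOpposite.smul_eq_mul_unop, MulOpposite.unop_op]
  rw [mul_comm, Complex.mul_conj, Complex.normSq_eq_norm_sq, Complex.ofReal_re]

/-- The noise `D i` enters directly and through quantization with total weight α² + αβ = α; as the
load carries the factor α/K, the matching resource price is `K * D`. -/
theorem re_dotProduct_uplinkCov_mulVec (hK : 0 < K) (S : Network Nc Nu Nb K)
    (lam : Fin Nc → Fin Nu → Fin K → ℝ) {D : Fin Nc → Matrix (Fin Nb) (Fin Nb) ℝ}
    (hD : ∀ i, (D i).IsDiag) (i : Fin Nc) (u : Fin Nu) (k : Fin K) (f : Fin Nb → ℂ) :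
    (star f ⬝ᵥ (uplinkCov S lam D i u k *ᵥ f)).re =
      (S.system hK).cost (fun a => lam a.1 a.2.1 a.2.2) (fun r => K * D r.1 r.2 r.2) (i, u, k)
        f := by
  have hK' : (K : ℝ) ≠ 0 := by exact_mod_cast hK.ne'
  have hDi : (D i).map Complex.ofReal = Matrix.diagonal fun m => ((D i m m : ℝ) : ℂ) := by
    ext m l
    by_cases h : m = l
    · subst h; simp
    · simp [h, hD i h]
  rw [uplinkCov, uplinkQuantCov_eq hK, hDi]
  simp only [Matrix.add_mulVec, Matrix.smul_mulVec, Matrix.sum_mulVec, dotProduct_add,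
    dotProduct_smul, dotProduct_sum, Complex.add_re, smul_eq_mul, Complex.re_ofReal_mul,
    Complex.re_sum, re_dotProduct_diagonal_mulVec, re_dotProduct_vecMulVec_mulVec]
  rw [← sum_interferers i u k fun j v k' => lam j v k' * ‖star (S.chan i j v k') ⬝ᵥ f‖ ^ 2]
  have h1 : ∑ a : Fin Nc × Fin Nu × Fin K, lam a.1 a.2.1 a.2.2 *
      (S.system hK).leak a (i, u, k) f =
      S.α ^ 2 * (∑ b : Fin Nc × Fin Nu × Fin K,
        if (i, u) ≠ (b.1, b.2.1) ∧ k = b.2.2 then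
          lam b.1 b.2.1 b.2.2 * ‖star (S.chan i b.1 b.2.1 b.2.2) ⬝ᵥ f‖ ^ 2 else 0)
      + S.α * S.β / K * ∑ m, (∑ a : Fin Nc × Fin Nu × Fin K,
        lam a.1 a.2.1 a.2.2 * ‖S.chan i a.1 a.2.1 a.2.2 m‖ ^ 2) * ‖f m‖ ^ 2 := by
    simp only [Finset.sum_mul]
    rw [Finset.sum_comm, Finset.mul_sum, Finset.mul_sum, ← Finset.sum_add_distrib]
    refine Finset.sum_congr rfl fun a _ => ?_
    simp only [Network.system, mul_add]
    congr 1
    · by_cases h : (i, u) ≠ (a.1, a.2.1) ∧ k = a.2.2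
      · rw [if_pos h, if_pos ⟨h.1.symm, h.2.symm⟩]; ring
      · rw [if_neg h, if_neg fun h' => h ⟨h'.1.symm, h'.2.symm⟩]; ring
    · simp only [Finset.mul_sum]
      exact Finset.sum_congr rfl fun m _ => by ring
  have h2 : ∑ r : Fin Nc × Fin Nb, K * D r.1 r.2 r.2 * (S.system hK).load (i, u, k) r f =
      S.α * ∑ m, D i m m * ‖f m‖ ^ 2 := by
    rw [Fintype.sum_prod_type, Finset.sum_eq_single i
      (fun j _ hj => by simp [Network.system, hj.symm]) (by simp), Finset.mul_sum]
    refine Finset.sum_congr rfl fun m _ => ?_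
    simp only [Network.system, if_true]
    field_simp
  have h3 : ∑ m, S.α * S.β * ((∑ a : Fin Nc × Fin Nu × Fin K,
        lam a.1 a.2.1 a.2.2 * ‖S.chan i a.1 a.2.1 a.2.2 m‖ ^ 2) / K + D i m m) * ‖f m‖ ^ 2 =
      S.α * S.β / K * (∑ m, (∑ a : Fin Nc × Fin Nu × Fin K,
        lam a.1 a.2.1 a.2.2 * ‖S.chan i a.1 a.2.1 a.2.2 m‖ ^ 2) * ‖f m‖ ^ 2)
      + S.α * S.β * ∑ m, D i m m * ‖f m‖ ^ 2 := by
    rw [Finset.mul_sum, Finset.mul_sum, ← Finset.sum_add_distrib]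
    exact Finset.sum_congr rfl fun m _ => by ring
  rw [CoupledSystem.cost, h1, h2, h3, Network.β]
  ring

theorem mem_uplinkFeasible_iff (hK : 0 < K) (S : Network Nc Nu Nb K)
    (lam : Fin Nc → Fin Nu → Fin K → ℝ) {D : Fin Nc → Matrix (Fin Nb) (Fin Nb) ℝ}
    (hD : D ∈ noiseSet Nc Nb) :
    lam ∈ uplinkFeasible S D ↔ (∀ i u k, 0 ≤ lam i u k) ∧
      (S.system hK).UplinkFeasible (fun a => lam a.1 a.2.1 a.2.2)
        (fun r => K * D r.1 r.2 r.2) := by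
  have hDnn : ∀ r : Fin Nc × Fin Nb, 0 ≤ (K : ℝ) * D r.1 r.2 r.2 := fun r =>
    mul_nonneg (Nat.cast_nonneg K) (hD.1 r.1).2.diag_nonneg
  simp only [uplinkFeasible, Set.mem_ofPred_eq, CoupledSystem.UplinkFeasible, Prod.forall]
  refine and_congr_right fun hlam => forall_congr' fun i => forall_congr' fun u =>
    forall_congr' fun k => exists_congr fun f => ?_
  have hγ := S.γ_pos i u k
  have hcost := (S.system hK).cost_nonneg (lam := fun a => lam a.1 a.2.1 a.2.2)
    (fun a => hlam _ _ _) hDnn (i, u, k) f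
  have hg : lam i u k * (S.system hK).gain (i, u, k) f =
      S.α ^ 2 * lam i u k * ‖star f ⬝ᵥ S.chan i i u k‖ ^ 2 / S.γ i u k := by
    simp only [Network.system, norm_star_dotProduct_comm f]
    ring
  rw [uplinkSqinr, re_dotProduct_uplinkCov_mulVec hK S lam fun i => (hD.1 i).1, hg]
  -- If the cost vanishes, the quotient is 0 and misses the positive target, and the right side
  -- fails as well.
  rcases hcost.eq_or_lt with h0 | hpos
  · rw [← h0]
    simp [hγ]
  · rw [le_div_iff₀ hpos, le_div_iff₀ hγ, mul_comm]
    simp [hpos]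

/-! ### The cycle of inequalities between the three optimal values -/

theorem uplinkValue_nonneg (S : Network Nc Nu Nb K) : 0 ≤ uplinkValue S := by
  have h0 : (0 : Fin Nc → Matrix (Fin Nb) (Fin Nb) ℝ) ∈ noiseSet Nc Nb :=
    ⟨fun _ => ⟨Matrix.isDiag_zero, Matrix.PosSemidef.zero⟩, by simp; positivity⟩
  refine le_trans ?_ (le_iSup₂_of_le (0 : Fin Nc → Matrix (Fin Nb) (Fin Nb) ℝ) h0 le_rfl)
  refine le_iInf₂ fun lam hlam => EReal.coe_nonneg.2 ?_
  exact Finset.sum_nonneg fun i _ => Finset.sum_nonneg fun u _ => Finset.sum_nonneg fun k _ =>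
    mul_nonneg (hlam.1 i u k) (sq_nonneg _)

theorem sum_uplinkPower (S : Network Nc Nu Nb K) (lam : Fin Nc → Fin Nu → Fin K → ℝ) :
    ∑ i, ∑ u, ∑ k, lam i u k * S.σ ^ 2 =
      S.σ ^ 2 * ∑ a : Fin Nc × Fin Nu × Fin K, lam a.1 a.2.1 a.2.2 := by
  simp only [Fintype.sum_prod_type, ← Finset.sum_mul]
  exact mul_comm _ _

theorem diagonal_mem_noiseSet {d : Fin Nc × Fin Nb → ℝ} (hd : ∀ r, 0 ≤ d r)
    (hsum : ∑ r, d r ≤ (Nc : ℝ) * Nb) :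
    (fun i => Matrix.diagonal fun m => d (i, m)) ∈ noiseSet Nc Nb :=
  ⟨fun _ => ⟨Matrix.isDiag_diagonal _, Matrix.PosSemidef.diagonal fun _ => hd _⟩, by
    simpa [Matrix.trace_diagonal, Fintype.sum_prod_type] using hsum⟩

/-- Normalized dual feasible prices bound the value of the virtual uplink from below. -/
theorem le_uplinkValue_of_dualFeasible (hK : 0 < K) (S : Network Nc Nu Nb K)
    {lam : Fin Nc → Fin Nu → Fin K → ℝ} {d : Fin Nc × Fin Nb → ℝ}
    (hd : ∀ r, 0 ≤ d r) (hsum : ∑ r, d r = (K : ℝ) * Nc * Nb)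
    (h : (S.system hK).DualFeasible (fun a => lam a.1 a.2.1 a.2.2) d) :
    ((S.σ ^ 2 * ∑ a : Fin Nc × Fin Nu × Fin K, lam a.1 a.2.1 a.2.2 : ℝ) : EReal) ≤
      uplinkValue S := by
  have hK' : (0 : ℝ) < K := by exact_mod_cast hK
  set V := S.σ ^ 2 * ∑ a : Fin Nc × Fin Nu × Fin K, lam a.1 a.2.1 a.2.2 with hV
  -- The comparison of prices needs positive resource prices, so `d` is mixed with the uniform
  -- prices `K`, which keeps the total trace at Nc Nb. The user prices shrink by `t`, which then
  -- tends to 1.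
  have key : ∀ t : ℝ, 0 < t → t < 1 → ((t * V : ℝ) : EReal) ≤ uplinkValue S := by
    intro t ht0 ht1
    have hpos : ∀ r, 0 < t * d r / K + (1 - t) := fun r =>
      add_pos_of_nonneg_of_pos (div_nonneg (mul_nonneg ht0.le (hd r)) hK'.le) (sub_pos.2 ht1)
    have hmem := diagonal_mem_noiseSet (d := fun r => t * d r / K + (1 - t))
      (fun r => (hpos r).le) (by
        rw [Finset.sum_add_distrib, ← Finset.sum_div, ← Finset.mul_sum, hsum]
        simp only [Finset.sum_const, Finset.card_univ, Fintype.card_prod, Fintype.card_fin,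
          nsmul_eq_mul]
        push_cast
        field_simp
        ring_nf
        rfl)
    refine le_iSup₂_of_le _ hmem (le_iInf₂ fun lam' hlam' => EReal.coe_le_coe_iff.2 ?_)
    obtain ⟨h0, h1⟩ := (mem_uplinkFeasible_iff hK S lam' hmem).1 hlam'
    simp only [Matrix.diagonal_apply_eq] at h1
    have hdual := (h.smul ht0.le).add (CoupledSystem.dualFeasible_zero (T := S.system hK)
      (d := fun _ => K * (1 - t)) fun _ => mul_nonneg hK'.le (sub_pos.2 ht1).le)
    rw [show t • d + (fun _ => K * (1 - t)) = fun r => (K : ℝ) * (t * d r / K + (1 - t)) by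
      funext r
      simp only [Pi.add_apply, Pi.smul_apply, smul_eq_mul]
      field_simp] at hdual
    have hle := hdual.le_of_uplinkFeasible h1 (fun a => h0 _ _ _)
      (fun r => mul_pos hK' (hpos r))
    rw [sum_uplinkPower, hV, mul_left_comm, Finset.mul_sum]
    refine mul_le_mul_of_nonneg_left (Finset.sum_le_sum fun a _ => ?_) (sq_nonneg _)
    simpa using hle a
  have h0 := uplinkValue_nonneg S
  induction hu : uplinkValue S with
  | bot => simp [hu] at h0
  | top => exact le_top
  | coe r =>
    rw [hu] at key h0
    rw [EReal.coe_le_coe_iff]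
    have hr : 0 ≤ r := EReal.coe_nonneg.1 h0
    by_contra! hlt
    have hV0 : 0 < V := hr.trans_lt hlt
    -- This `t` makes `t * V` the midpoint of `r` and `V`.
    have := EReal.coe_le_coe_iff.1 (key ((r + V) / (2 * V)) (by positivity)
      ((div_lt_one (by positivity)).2 (by linarith)))
    rw [show (r + V) / (2 * V) * V = (r + V) / 2 by field_simp] at this
    linarith

section Signal

variable {S : Network Nc Nu Nb K} {Ω : Type*} [MeasurableSpace Ω] {P : Measure Ω}

/-- Normalized dual feasible multipliers are handled by the comparison of prices. For all others a
single point with Lagrangian 0 suffices, because the uplink value is nonnegative. -/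
theorem SignalModel.lagrangeDualValue_le_uplinkValue (M : SignalModel S P) (hK : 0 < K) :
    M.lagrangeDualValue ≤ uplinkValue S := by
  classical
  refine iSup_le fun μ => iSup_le fun ν => iSup_le fun ⟨hμ, hν⟩ => ?_
  have h0 := uplinkValue_nonneg S
  have hzero : ∀ p₀ : ℝ, M.lagrangian 0 p₀ μ ν =
      ((K : ℝ) * Nc * Nb - ∑ r : Fin Nc × Fin Nb, ∑ k, ν r.1 r.2 k) * p₀
      + S.σ ^ 2 * ∑ a : Fin Nc × Fin Nu × Fin K, μ a.1 a.2.1 a.2.2 := fun p₀ => by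
    have hb : ∀ b : Fin Nc × Fin Nu × Fin K, beams (0 : Beamformers Nc Nu Nb K) b = 0 :=
      fun b => rfl
    rw [M.lagrangian_eq hK]
    simp [hb, CoupledSystem.cost_zero, CoupledSystem.gain_zero]
  set V := S.σ ^ 2 * ∑ a : Fin Nc × Fin Nu × Fin K, μ a.1 a.2.1 a.2.2 with hV
  have hV0 : 0 ≤ V := mul_nonneg (sq_nonneg _) (Finset.sum_nonneg fun a _ => hμ _ _ _)
  by_cases hsum : ∑ r : Fin Nc × Fin Nb, ∑ k, ν r.1 r.2 k = (K : ℝ) * Nc * Nb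
  · by_cases hdual : (S.system hK).DualFeasible (fun a => μ a.1 a.2.1 a.2.2)
      (fun r => ∑ k, ν r.1 r.2 k)
    · refine (iInf₂_le (0 : Beamformers Nc Nu Nb K) (0 : ℝ)).trans ?_
      rw [hzero, mul_zero, zero_add]
      exact le_uplinkValue_of_dualFeasible hK S
        (fun r => Finset.sum_nonneg fun k _ => hν _ _ _) hsum hdual
    · simp only [CoupledSystem.DualFeasible, not_forall, not_le] at hdual
      obtain ⟨b, f, hbf⟩ := hdual
      set δ := μ b.1 b.2.1 b.2.2 * (S.system hK).gain b f - (S.system hK).cost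
        (fun a => μ a.1 a.2.1 a.2.2) (fun r => ∑ k, ν r.1 r.2 k) b f with hδ
      have hδ0 : 0 < δ := sub_pos.2 hbf
      -- A profitable vector, scaled so that its profit is exactly `V` and cancels the constant
      -- term.
      set v : Fin Nc × Fin Nu × Fin K → Fin Nb → ℂ :=
        Pi.single b (Real.sqrt (V / δ) • f) with hv
      have hbv : beams (fun i k => Matrix.of fun m u => v (i, u, k) m) = v := rfl
      have hsingle : ∑ c, ((S.system hK).cost (fun a => μ a.1 a.2.1 a.2.2)
          (fun r => ∑ k, ν r.1 r.2 k) c (v c) -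
          μ c.1 c.2.1 c.2.2 * (S.system hK).gain c (v c)) = -(V / δ * δ) := by
        rw [Finset.sum_eq_single b (fun c _ hc => by
          simp [hv, hc, CoupledSystem.cost_zero, CoupledSystem.gain_zero]) (by simp), hv,
          Pi.single_eq_same, CoupledSystem.cost_smul, CoupledSystem.gain_smul,
          Real.sq_sqrt (by positivity)]
        linarith [congrArg (V / δ * ·) hδ]
      refine (iInf₂_le (fun i k => Matrix.of fun m u => v (i, u, k) m : Beamformers Nc Nu Nb K)
        (0 : ℝ)).trans (le_of_eq_of_le ?_ h0)
      rw [M.lagrangian_eq hK, hbv, hsingle, div_mul_cancel₀ _ hδ0.ne', ← hV, mul_zero, zero_add,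
        add_neg_cancel, EReal.coe_zero]
  · have hne : (K : ℝ) * Nc * Nb - ∑ r : Fin Nc × Fin Nb, ∑ k, ν r.1 r.2 k ≠ 0 :=
      sub_ne_zero.2 (Ne.symm hsum)
    refine (iInf₂_le (0 : Beamformers Nc Nu Nb K)
      (-V / ((K : ℝ) * Nc * Nb - ∑ r : Fin Nc × Fin Nb, ∑ k, ν r.1 r.2 k))).trans
      (le_of_eq_of_le ?_ h0)
    rw [hzero, mul_div_cancel₀ _ hne, neg_add_cancel, EReal.coe_zero]

theorem SignalModel.uplinkValue_le_primalValue (M : SignalModel S P) (hNc : 0 < Nc)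
    (hNb : 0 < Nb) (hK : 0 < K) :
    uplinkValue S ≤ (((K : ℝ) * Nc * Nb : ℝ) : EReal) * M.primalValue := by
  have hκ : (0 : ℝ) < (K : ℝ) * Nc * Nb := by positivity
  rw [← EReal.div_le_iff_le_mul (EReal.coe_pos.2 hκ) (EReal.coe_ne_top _)]
  refine le_iInf₂ fun ⟨w, p₀⟩ hw => ?_
  rw [EReal.div_le_iff_le_mul (EReal.coe_pos.2 hκ) (EReal.coe_ne_top _), ← EReal.coe_mul]
  obtain ⟨hw1, hw2⟩ := (M.mem_primalFeasible_iff hK w p₀).1 hw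
  -- The sign matters because the trace of `D` is only bounded above; it comes from the load of some
  -- antenna.
  have hp₀ : 0 ≤ p₀ := le_trans
    (Finset.sum_nonneg fun b _ => (S.system hK).load_nonneg _ _ _) (hw2 (⟨0, hNc⟩, ⟨0, hNb⟩))
  refine iSup₂_le fun D hD => EReal.le_of_forall_lt_iff_le.1 fun z hz => ?_
  have hz' : (K : ℝ) * Nc * Nb * p₀ < z := EReal.coe_lt_coe_iff.1 hz
  obtain ⟨lam, hlam, hup, hle⟩ := CoupledSystem.exists_uplinkFeasible (T := S.system hK)
    (d := fun r => K * D r.1 r.2 r.2) (sq_pos_of_pos S.σ_pos) (sub_pos.2 hz')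
    (fun r => mul_nonneg (Nat.cast_nonneg K) (hD.1 r.1).2.diag_nonneg) hw1 hw2
  refine (iInf₂_le (fun i u k => lam (i, u, k))
    ((mem_uplinkFeasible_iff hK S _ hD).2 ⟨fun i u k => hlam _, hup⟩)).trans ?_
  rw [sum_uplinkPower, EReal.coe_le_coe_iff]
  have htr : ∑ r : Fin Nc × Fin Nb, D r.1 r.2 r.2 ≤ (Nc : ℝ) * Nb := by
    simpa [Matrix.trace, Fintype.sum_prod_type] using hD.2
  rw [← Finset.mul_sum] at hle
  have h1 : p₀ * (K * ∑ r : Fin Nc × Fin Nb, D r.1 r.2 r.2) ≤ p₀ * (K * ((Nc : ℝ) * Nb)) := by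
    gcongr
  simp only [Prod.mk.eta]
  linarith

/-- For real `z` below the left side, the power level `z / (K Nc Nb)` is infeasible, and the
separating prices keep the Lagrangian above `z` everywhere. An infeasible downlink admits every `z`.
-/
theorem SignalModel.primalValue_le_lagrangeDualValue (M : SignalModel S P) (hNc : 0 < Nc)
    (hNb : 0 < Nb) (hK : 0 < K) :
    (((K : ℝ) * Nc * Nb : ℝ) : EReal) * M.primalValue ≤ M.lagrangeDualValue := by
  have hκ : (0 : ℝ) < (K : ℝ) * Nc * Nb := by positivity
  have hK' : (K : ℝ) ≠ 0 := by positivity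
  have : Nonempty (Fin Nc × Fin Nb) := ⟨(⟨0, hNc⟩, ⟨0, hNb⟩)⟩
  refine EReal.ge_of_forall_gt_iff_ge.1 fun z hz => ?_
  have hz' : z = (K : ℝ) * Nc * Nb * (z / ((K : ℝ) * Nc * Nb)) := by field_simp
  have hinf : ¬ ∃ v : Fin Nc × Fin Nu × Fin K → Fin Nb → ℂ,
      (∀ a, S.σ ^ 2 ≤ (S.system hK).margin v a) ∧
      ∀ r, (S.system hK).totalLoad v r ≤ z / ((K : ℝ) * Nc * Nb) := by
    rintro ⟨v, hv⟩
    have hle : M.primalValue ≤ ((z / ((K : ℝ) * Nc * Nb) : ℝ) : EReal) :=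
      iInf₂_le ((fun i k => Matrix.of fun m u => v (i, u, k) m : Beamformers Nc Nu Nb K),
        z / ((K : ℝ) * Nc * Nb)) ((M.mem_primalFeasible_iff hK _ _).2 hv)
    refine hz.not_ge ((mul_le_mul_of_nonneg_left hle (EReal.coe_nonneg.2 hκ.le)).trans_eq ?_)
    rw [← EReal.coe_mul, ← hz']
  obtain ⟨lam, d, hlam, hd, hdual, hsum, hle⟩ :=
    CoupledSystem.exists_dualFeasible_le (sq_pos_of_pos S.σ_pos) hκ hinf
  rw [← hz'] at hle
  -- The price of an antenna is split evenly over the K power constraints it stands for.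
  refine le_iSup_of_le (fun i u k => lam (i, u, k)) (le_iSup_of_le (fun i m _ => d (i, m) / K)
    (le_iSup_of_le ⟨fun i u k => hlam _, fun i m k => div_nonneg (hd _) (Nat.cast_nonneg K)⟩
      (le_iInf₂ fun w p₀ => EReal.coe_le_coe_iff.2 ?_)))
  have hν : ∀ r : Fin Nc × Fin Nb, ∑ _k : Fin K, d r / (K : ℝ) = d r := fun r => by
    simp only [Finset.sum_const, Finset.card_univ, Fintype.card_fin, nsmul_eq_mul]
    field_simp
  rw [M.lagrangian_eq hK]
  simp only [Prod.mk.eta, hν, hsum, sub_self, zero_mul, zero_add]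
  exact le_add_of_le_of_nonneg hle (Finset.sum_nonneg fun b _ => sub_nonneg.2 (hdual b _))

end Signal

end QuantizedCoMP

end

theorem mainTheorem2 {Nc Nu Nb K : ℕ} (hNc : 0 < Nc) (hNb : 0 < Nb) (hK : 0 < K)
    (S : QuantizedCoMP.Network Nc Nu Nb K)
    {Ω : Type*} [MeasurableSpace Ω] (P : MeasureTheory.Measure Ω)
    [MeasureTheory.IsProbabilityMeasure P] (M : QuantizedCoMP.SignalModel S P) :
    M.lagrangeDualValue = (((K : ℝ) * Nc * Nb : ℝ) : EReal) * M.primalValue ∧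
      QuantizedCoMP.uplinkValue S = (((K : ℝ) * Nc * Nb : ℝ) : EReal) * M.primalValue := by
  have h1 := M.lagrangeDualValue_le_uplinkValue hK
  have h2 := M.uplinkValue_le_primalValue hNc hNb hK
  have h3 := M.primalValue_le_lagrangeDualValue hNc hNb hK
  exact ⟨(h1.trans h2).antisymm h3, h2.antisymm (h3.trans h1)⟩
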